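/- Let $N\ge 1$, let $L\subset\mathbb Z^N$ be a saturated lattice (i.e. $(L\otimes\mathbb R)\cap\mathbb Z^N=L$) of rank $d$ contained in the hyperplane $\sum_i l_i=0$, and put $r=N-d$. Let $A$ be an integer $r\times N$ matrix with columns $\mathbf a_1,\dots,\mathbf a_N$ whose integer kernel is $L$, and let $B$ be an integer $d\times N$ matrix with columns $\mathbf b_1,\dots,\mathbf b_N$ whose rows form a $\mathbb Z$-basis of $L$. Let $\gamma_0\in\mathbb R^N$ be such that $\alpha=A\gamma_0$ is totally non-resonant, i.e. for any $r-1$ linearly independent columns $\mathbf a_{j_1},\dots,\mathbf a_{j_{r-1}}$ of $A$ the cone $\langle\mathbf a_{j_1},\dots,\mathbf a_{j_{r-1}}\rangle_{\mathbb R_{\ge0}}$ does not meet $\alpha+\mathbb Z^r$. A cotriangle is a set $I\subset\{1,\dots,N\}$ of $d$ indices such that the vectors $\mathbf b_i$, $i\in I$, are linearly independent. A cotriangulation of $B$ is a set of the form $\mathcal I_\rho$, where $\rho\in\mathbb R^d$ is not in the linear span of any $d-1$ of the vectors $\mathbf b_i$ and $\mathcal I_\rho$ is the set of all cotriangles $I$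 such that $\rho$ lies in the cone generated by the $\mathbf b_i$, $i\in I$. A solution point is a $\mu\in[0,1)^d$ such that $\gamma^\mu:=\gamma_0+\mu B$ has integral components at all indices of some cotriangle; by total non-resonance that cotriangle is then exactly the set $I(\mu)$ of all indices at which $\gamma^\mu$ is integral. Put $x_j=e^{2\pi i\gamma_{0,j}}$, $f_j(\mathbf z)=x_j\mathbf z^{\mathbf b_j}-1$, and, for $\tau\in\mathbb Z^d$, $$\omega(\tau,\mathbf z)=\frac{\mathbf z^\tau}{f_1(\mathbf z)\cdots f_N(\mathbf z)}\,\frac{dz_1}{z_1}\wedge\cdots\wedge\frac{dz_d}{z_d}.$$ For a solution point $\mu$ with $I=I(\mu)=\{I_1<\dots<I_d\}$ and $\zeta^\mu=(e^{2\pi i\mu_1},\dots,e^{2\pi i\mu_d})$, the residue of $\omega$ at $\zeta^\mu$ is $$\operatorname{Res}_{\mathbf z=\zeta^\mu}\omega(\tau,\mathbf z)=\operatorname{sign}(\det(\mathbf b_{I_1},\dots,\mathbf b_{I_d}))\,\frac{(\zeta^\mu)^\tau}{J_I(\zeta^\mu)\prod_{j\notin I}f_j(\zeta^\mu)},\qquad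 J_I(\mathbf z)=\det\Big(z_k\frac{\partial f_{I_c}}{\partial z_k}\Big)_{k,c}.$$ Let $\mathcal I$ and $\mathcal J$ be any two cotriangulations of $B$, and let $\tau\in\mathbb Z^d$ be an integral point of the open zonotope $Z_B^\circ=\{\sum_{i=1}^N\nu_i\mathbf b_i : 0<\nu_i<1\}$. Then there are only finitely many solution points $\mu$ with $I(\mu)\in\mathcal I$, likewise for $\mathcal J$, and $$\sum_{\mu:\,I(\mu)\in\mathcal I}\operatorname{Res}_{\mathbf z=\zeta^\mu}\omega(\tau,\mathbf z)=\sum_{\nu:\,I(\nu)\in\mathcal J}\operatorname{Res}_{\mathbf z=\zeta^\nu}\omega(\tau,\mathbf z).$$ -/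

import Mathlib

open scoped Matrix

noncomputable section

namespace AHyp

/-- The standing assumptions on the lattice `L ⊆ ℤ^N`: it has rank `d`, it lies in the hyperplane
`∑ l_i = 0`, and it is saturated, i.e. `(L ⊗ ℝ) ∩ ℤ^N = L`. -/
structure IsHypergeometricLattice (d : ℕ) {N : ℕ} (L : Submodule ℤ (Fin N → ℤ)) : Prop where
  rank_eq : Module.finrank ℤ L = d
  sum_eq_zero : ∀ l ∈ L, ∑ i, l i = 0
  saturated : ∀ v : Fin N → ℤ,
    (fun i => (v i : ℝ)) ∈
      Submodule.span ℝ ((fun (l : Fin N → ℤ) (i : Fin N) => (l i : ℝ)) '' (L : Set (Fin N → ℤ))) →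
    v ∈ L

/-- `L` is the integer kernel of the matrix `A`. -/
def IsIntegerKernel {r N : ℕ} (A : Matrix (Fin r) (Fin N) ℤ) (L : Submodule ℤ (Fin N → ℤ)) :
    Prop :=
  ∀ v : Fin N → ℤ, v ∈ L ↔ A *ᵥ v = 0

/-- The rows of `B` form a `ℤ`-basis of `L`. -/
def HasBasisRows {d N : ℕ} (B : Matrix (Fin d) (Fin N) ℤ) (L : Submodule ℤ (Fin N → ℤ)) : Prop :=
  LinearIndependent ℤ B.row ∧ Submodule.span ℤ (Set.range B.row) = L

/-- The `i`-th column of an integer matrix, as a real vector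
(`a_i` for the matrix `A`, `b_i` for the matrix `B`). -/
def realCol {m N : ℕ} (M : Matrix (Fin m) (Fin N) ℤ) (i : Fin N) : Fin m → ℝ :=
  fun k => (M k i : ℝ)

/-- The closed cone `⟨m_i : i ∈ I⟩_{ℝ ≥ 0}` generated by the columns with index in `I`. -/
def cone {m N : ℕ} (M : Matrix (Fin m) (Fin N) ℤ) (I : Finset (Fin N)) : Set (Fin m → ℝ) :=
  {v | ∃ c : Fin N → ℝ, (∀ i ∈ I, 0 ≤ c i) ∧ v = ∑ i ∈ I, c i • realCol M i}

/-- Total non-resonance of the parameter `α`: no cone spanned by `r - 1` linearly independent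
columns of `A` meets `α + ℤ^r`. -/
def TotallyNonResonant {r N : ℕ} (A : Matrix (Fin r) (Fin N) ℤ) (α : Fin r → ℝ) : Prop :=
  ∀ J : Finset (Fin N), J.card + 1 = r →
    LinearIndependent ℝ (fun j : J => realCol A j) →
    ∀ n : Fin r → ℤ, (fun k => α k + (n k : ℝ)) ∉ cone A J

/-- A cotriangle: `d` indices whose columns of `B` are linearly independent. -/
def IsCotriangle {d N : ℕ} (B : Matrix (Fin d) (Fin N) ℤ) (I : Finset (Fin N)) : Prop :=
  I.card = d ∧ LinearIndependent ℝ (fun i : I => realCol B i)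

/-- A (generic) convergence direction: a point of `ℝ^d` that is not in the span of any `d - 1` of
the vectors `b_i`. -/
def IsConvergenceDirection {d N : ℕ} (B : Matrix (Fin d) (Fin N) ℤ) (ρ : Fin d → ℝ) : Prop :=
  ∀ K : Finset (Fin N), K.card + 1 = d →
    ρ ∉ Submodule.span ℝ (realCol B '' (K : Set (Fin N)))

/-- The set `𝓘_ρ` of the cotriangles whose cone contains `ρ`. -/
def cotrianglesAt {d N : ℕ} (B : Matrix (Fin d) (Fin N) ℤ) (ρ : Fin d → ℝ) :
    Set (Finset (Fin N)) :=
  {I | IsCotriangle B I ∧ ρ ∈ cone B I}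

/-- A cotriangulation of `B`: a set of the form `𝓘_ρ` for a convergence direction `ρ`. -/
def IsCotriangulation {d N : ℕ} (B : Matrix (Fin d) (Fin N) ℤ) (𝓘 : Set (Finset (Fin N))) : Prop :=
  ∃ ρ : Fin d → ℝ, IsConvergenceDirection B ρ ∧ 𝓘 = cotrianglesAt B ρ

/-- The parameter vector `γ^μ = γ₀ + μ B`. -/
def gammaVec {d N : ℕ} (B : Matrix (Fin d) (Fin N) ℤ) (γ₀ : Fin N → ℝ) (μ : Fin d → ℝ) :
    Fin N → ℝ :=
  fun i => γ₀ i + ∑ k, μ k * (B k i : ℝ)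

/-- Solution points: `μ ∈ [0,1)^d` such that `γ^μ` is integral on some cotriangle. -/
def IsSolutionPoint {d N : ℕ} (B : Matrix (Fin d) (Fin N) ℤ) (γ₀ : Fin N → ℝ) (μ : Fin d → ℝ) :
    Prop :=
  (∀ k, μ k ∈ Set.Ico (0 : ℝ) 1) ∧
    ∃ I, IsCotriangle B I ∧ ∀ i ∈ I, ∃ n : ℤ, gammaVec B γ₀ μ i = n

open Classical in
/-- The index set `I(μ)`: the indices at which `γ^μ` is integral. Under total non-resonance, for a
solution point `μ`, this is the one and only cotriangle on which `γ^μ` is integral. -/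
def indexSet {d N : ℕ} (B : Matrix (Fin d) (Fin N) ℤ) (γ₀ : Fin N → ℝ) (μ : Fin d → ℝ) :
    Finset (Fin N) :=
  Finset.univ.filter fun i => ∃ n : ℤ, gammaVec B γ₀ μ i = n

/-- The set of all solution points `μ` with `I(μ) ∈ 𝓘`. -/
def solutionPoints {d N : ℕ} (B : Matrix (Fin d) (Fin N) ℤ) (γ₀ : Fin N → ℝ)
    (𝓘 : Set (Finset (Fin N))) : Set (Fin d → ℝ) :=
  {μ | IsSolutionPoint B γ₀ μ ∧ indexSet B γ₀ μ ∈ 𝓘}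

/-- The open zonotope `Z_B° = {∑ ν_i b_i : 0 < ν_i < 1}`. -/
def openZonotope {d N : ℕ} (B : Matrix (Fin d) (Fin N) ℤ) : Set (Fin d → ℝ) :=
  {v | ∃ ν : Fin N → ℝ, (∀ i, 0 < ν i ∧ ν i < 1) ∧ v = ∑ i, ν i • realCol B i}

/-- The Laurent monomial `z^n = z_1^{n_1} ⋯ z_d^{n_d}`. -/
def monomial {d : ℕ} (z : Fin d → ℂ) (n : Fin d → ℤ) : ℂ :=
  ∏ k, z k ^ n k

/-- The function `f_i(z) = x_i z^{b_i} - 1` with `x_i = e^{2 π i γ_{0,i}}`. -/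
def f {d N : ℕ} (B : Matrix (Fin d) (Fin N) ℤ) (γ₀ : Fin N → ℝ) (i : Fin N) (z : Fin d → ℂ) : ℂ :=
  Complex.exp (2 * Real.pi * Complex.I * (γ₀ i : ℂ)) * monomial z (fun k => B k i) - 1

/-- The Jacobian `J_I(z) = det (z_k ∂f_{I_c} / ∂z_k)_{k,c}`, where `I_1 < ⋯ < I_d` are the elements
of `I`. -/
def jacobian {d N : ℕ} (B : Matrix (Fin d) (Fin N) ℤ) (γ₀ : Fin N → ℝ) (I : Finset (Fin N))
    (hI : I.card = d) (z : Fin d → ℂ) : ℂ :=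
  Matrix.det (Matrix.of fun k c : Fin d =>
    z k * deriv (fun w => f B γ₀ (I.orderEmbOfFin hI c) (Function.update z k w)) (z k))

/-- The square submatrix `B_I` of the columns `b_i`, `i ∈ I`, in increasing order of `i`. -/
def subB {d N : ℕ} (B : Matrix (Fin d) (Fin N) ℤ) (I : Finset (Fin N)) (hI : I.card = d) :
    Matrix (Fin d) (Fin d) ℤ :=
  B.submatrix id (I.orderEmbOfFin hI)

/-- The point `ζ^μ = e^{2 π i μ}` of the torus `(ℂ^×)^d`. -/
def zeta {d : ℕ} (μ : Fin d → ℝ) : Fin d → ℂ :=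
  fun k => Complex.exp (2 * Real.pi * Complex.I * (μ k : ℂ))

/-- The residue at `z = ζ^μ` of the rational differential form
`ω(τ,z) = z^τ / (f_1(z) ⋯ f_N(z)) dz_1/z_1 ∧ ⋯ ∧ dz_d/z_d`, that is, with `I = I(μ)`,
`sign(det B_I) · ζ^τ / (J_I(ζ) ∏_{j ∉ I} f_j(ζ))`, `ζ = ζ^μ`.
The value `0` is a placeholder for those `μ` for which `I(μ)` does not have `d` elements. -/
def residue {d N : ℕ} (B : Matrix (Fin d) (Fin N) ℤ) (γ₀ : Fin N → ℝ) (τ : Fin d → ℤ)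
    (μ : Fin d → ℝ) : ℂ :=
  if hI : (indexSet B γ₀ μ).card = d then
    ((subB B (indexSet B γ₀ μ) hI).det.sign : ℂ) *
      (monomial (zeta μ) τ /
        (jacobian B γ₀ (indexSet B γ₀ μ) hI (zeta μ) *
          ∏ j ∈ (indexSet B γ₀ μ)ᶜ, f B γ₀ j (zeta μ)))
  else 0

end AHyp

end

noncomputable section

namespace AHyp

open Polynomial Finset

/-! The argument combines a residue theorem on curves with a count of cones.

To an ordered tuple `T` of `d` indices attach `residueSum`: up to the sign of the determinant, the
sum of the residues of ω at the common zeros of the `f_(T c)`. Fix all entries of `T` but the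
`i`-th. The remaining `d - 1` equations cut out finitely many translates of a one-parameter subgroup
`t ↦ t^c`, and on each of them ω becomes a one-variable form `t^m / ∏ (y_j t^(D_j) - 1) dt/t`. Total
non-resonance makes its poles on the torus simple, and `τ` in the open zonotope excludes poles at
`0` and `∞`, so its residues add up to zero. Hence summing `residueSum` over the `i`-th entry gives
zero (`sum_residueSum_update_eq_zero`): the weights form a cycle.

For a basis `w`, let `coneSign ρ w` be the sign of `det w` if `ρ` lies in its cone and zero
otherwise. Following the half-line `ρ + s ρ'`, `s ≥ 0`, and counting the facets it crosses, one gets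
`coneSign ρ w - coneSign ρ' w` as the sum over `i` of `coneSign ρ` of `w` with row `i` replaced by
`-ρ'` (`coneSign_sub_coneSign`). The `i`-th summand no longer sees the `i`-th entry of `T`, so the
cycle relation kills it after summation against `residueSum`. Thus the weighted count of cones is
independent of `ρ` (`sum_mul_coneSign_eq`). Each cotriangle comes from `d!` tuples, so this count is
`d!` times the sum of residues over the cotriangulation (`factorial_mul_finsum_residue_eq`). -/

/-! ### Residue sums in one variable. -/

/-- The sum of `Q(t) / P'(t)` over the roots `t` of `P` vanishes if all the roots are simple and
`deg Q + 2 ≤ deg P`. -/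
theorem sum_eval_div_eval_derivative_eq_zero {P Q : ℂ[X]}
    (hsimple : ∀ t, P.IsRoot t → P.derivative.eval t ≠ 0) (hdeg : Q.natDegree + 2 ≤ P.natDegree) :
    ∑ t ∈ P.roots.toFinset, Q.eval t / P.derivative.eval t = 0 := by
  classical
  have hP : P ≠ 0 := by rintro rfl; simp at hdeg
  have hnodup : P.roots.Nodup := by
    rw [Multiset.nodup_iff_count_le_one]
    intro a
    rw [count_roots]
    by_contra! h
    have := (one_lt_rootMultiplicity_iff_isRoot hP).1 h
    exact hsimple a this.1 this.2
  set s := P.roots.toFinset with hs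
  have hcard : s.card = P.natDegree := by
    rw [hs, Multiset.toFinset_card_of_nodup hnodup]
    exact (IsAlgClosed.splits P).natDegree_eq_card_roots.symm
  have hfac : P = C P.leadingCoeff * Lagrange.nodal s id := by
    conv_lhs => rw [(IsAlgClosed.splits P).eq_prod_roots]
    rw [Lagrange.nodal_eq, hs, Finset.prod_eq_multiset_prod, Multiset.toFinset_val,
      Multiset.dedup_eq_self.2 hnodup]
    rfl
  have hder : ∀ t ∈ s, P.derivative.eval t =
      P.leadingCoeff * ∏ j ∈ s.erase t, (t - j) := by
    intro t ht
    conv_lhs => rw [hfac]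
    have h := Lagrange.eval_nodal_derivative_eval_node_eq (v := (id : ℂ → ℂ)) ht
    simp only [id] at h
    rw [derivative_C_mul, eval_C_mul, h, Lagrange.eval_nodal]
    rfl
  have hQ : Q.degree < s.card := by
    rw [hcard]
    exact lt_of_le_of_lt degree_le_natDegree (by exact_mod_cast (by omega))
  -- Lagrange interpolation at the `n` roots expresses the coefficient of `X^(n-1)` in `Q` as the
  -- sum of `Q(t) / ∏ (t - j)`; that coefficient is zero by the degree bound.
  have h := Lagrange.coeff_eq_sum (s := s) (v := id) (P := Q) Function.injective_id.injOn hQ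
  rw [coeff_eq_zero_of_natDegree_lt (by omega)] at h
  rw [sum_congr rfl fun t ht => by rw [hder t ht, mul_comm, ← div_div], ← sum_div]
  simp only [id] at h
  rw [← h, zero_div]

/-- The polynomial `y X^(D⁺) - X^(D⁻)`, whose roots are the solutions of `y t^D = 1`. -/
def binomialPoly (y : ℂ) (D : ℤ) : ℂ[X] := C y * X ^ D.toNat - X ^ (-D).toNat

theorem zpow_toNat_neg_mul {t : ℂ} (ht : t ≠ 0) (D : ℤ) :
    t ^ (-D).toNat * t ^ D = t ^ D.toNat := by
  rw [← zpow_natCast, ← zpow_natCast, ← zpow_add₀ ht]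
  congr 1
  omega

theorem eval_binomialPoly {t : ℂ} (ht : t ≠ 0) (y : ℂ) (D : ℤ) :
    (binomialPoly y D).eval t = t ^ (-D).toNat * (y * t ^ D - 1) := by
  have := zpow_toNat_neg_mul ht D
  simp only [binomialPoly, eval_sub, eval_mul, eval_C, eval_pow, eval_X]
  rw [← this]; ring

theorem eval_zero_binomialPoly_ne_zero {y : ℂ} (hy : y ≠ 0) {D : ℤ} (hD : D ≠ 0) :
    (binomialPoly y D).eval 0 ≠ 0 := by
  simp only [binomialPoly, eval_sub, eval_mul, eval_C, eval_pow, eval_X]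
  rcases lt_or_gt_of_ne hD with h | h
  · have h1 : D.toNat = 0 := by omega
    have h2 : (-D).toNat ≠ 0 := by omega
    simp [h1, h2, hy]
  · have h1 : D.toNat ≠ 0 := by omega
    have h2 : (-D).toNat = 0 := by omega
    simp [h1, h2]

theorem natDegree_binomialPoly {y : ℂ} (hy : y ≠ 0) (D : ℤ) :
    (binomialPoly y D).natDegree = D.toNat + (-D).toNat := by
  unfold binomialPoly
  rcases lt_trichotomy D 0 with h | h | h
  · have h1 : D.toNat = 0 := by omega
    have h2 : 0 < (-D).toNat := by omega
    rw [h1, pow_zero, mul_one, natDegree_sub, natDegree_sub_C, natDegree_X_pow, zero_add]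
  · subst h
    rw [show C y * X ^ (0 : ℤ).toNat - X ^ (-0 : ℤ).toNat = C (y - 1) by simp, natDegree_C]
    rfl
  · have h1 : 0 < D.toNat := by omega
    have h2 : (-D).toNat = 0 := by omega
    rw [h2, pow_zero, ← C_1, natDegree_sub_C, natDegree_C_mul_X_pow _ _ hy, add_zero]

/-- The nonzero solutions of `y t^D = 1`, the empty set for `D = 0`. -/
def binomialRoots (y : ℂ) (D : ℤ) : Finset ℂ := (binomialPoly y D).roots.toFinset

theorem mem_binomialRoots {y : ℂ} (hy : y ≠ 0) {D : ℤ} {t : ℂ} :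
    t ∈ binomialRoots y D ↔ D ≠ 0 ∧ t ≠ 0 ∧ y * t ^ D = 1 := by
  rw [binomialRoots, Multiset.mem_toFinset]
  by_cases hD : D = 0
  · subst hD
    rw [show binomialPoly y 0 = C (y - 1) by simp [binomialPoly], roots_C]
    simp
  have h0 : binomialPoly y D ≠ 0 := by
    intro h
    exact eval_zero_binomialPoly_ne_zero hy hD (by rw [h, eval_zero])
  rw [mem_roots h0, IsRoot.def]
  by_cases ht : t = 0
  · subst ht
    simp [eval_zero_binomialPoly_ne_zero hy hD]
  · rw [eval_binomialPoly ht]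
    simp [hD, ht, sub_eq_zero]

theorem eval_derivative_binomialPoly {y : ℂ} {D : ℤ} {t : ℂ} (ht : t ≠ 0) (h : y * t ^ D = 1) :
    t * (binomialPoly y D).derivative.eval t = D * t ^ (-D).toNat := by
  have h1 := zpow_toNat_neg_mul ht D
  have hpow : ∀ n : ℕ, t * (n * t ^ (n - 1)) = n * t ^ n := by
    rintro (_ | n)
    · simp
    · rw [Nat.add_sub_cancel, pow_succ]; ring
  have h2 : (D : ℂ) = (D.toNat : ℂ) - ((-D).toNat : ℂ) := by
    have : D = (D.toNat : ℤ) - ((-D).toNat : ℤ) := by omega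
    exact_mod_cast congrArg (Int.cast : ℤ → ℂ) this
  simp only [binomialPoly, derivative_sub, derivative_C_mul, derivative_X_pow, eval_sub, eval_mul,
    eval_C, eval_pow, eval_X]
  rw [mul_sub, mul_left_comm, hpow, hpow, h2, ← h1]
  linear_combination (D.toNat : ℂ) * t ^ (-D).toNat * h

/-- The sum of the residues of `t^m / ∏ (y_j t^(D_j) - 1) dt/t` at its nonzero poles vanishes when
there are no poles at `0` and `∞`. -/
theorem sum_residues_eq_zero {ι : Type*} [DecidableEq ι] (s : Finset ι) {y : ι → ℂ} {D : ι → ℤ}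
    {m : ℤ} (hy : ∀ i ∈ s, y i ≠ 0)
    (hlow : -∑ i ∈ s, ((-D i).toNat : ℤ) < m) (hupp : m < ∑ i ∈ s, ((D i).toNat : ℤ))
    (hsep : ∀ i ∈ s, ∀ j ∈ s, i ≠ j → ∀ t ∈ binomialRoots (y i) (D i), y j * t ^ D j - 1 ≠ 0) :
    ∑ j ∈ s, ∑ t ∈ binomialRoots (y j) (D j),
      t ^ m / (D j * ∏ l ∈ s.erase j, (y l * t ^ D l - 1)) = 0 := by
  classical
  -- Without any root there is nothing to sum. Otherwise a root `t₀` together with `hsep` rules out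
  -- `D i = 0`, `y i = 1`, the case in which `binomialPoly` is zero.
  by_cases hempty : ∀ j ∈ s, binomialRoots (y j) (D j) = ∅
  · exact sum_eq_zero fun j hj => by rw [hempty j hj, sum_empty]
  push Not at hempty
  obtain ⟨j₀, hj₀, t₀, ht₀⟩ := hempty
  have hP0 : ∀ i ∈ s, binomialPoly (y i) (D i) ≠ 0 := by
    intro i hi h
    obtain ⟨hD, ht, -⟩ := (mem_binomialRoots (hy _ hj₀)).1 ht₀
    by_cases hij : i = j₀
    · subst hij
      simp [binomialRoots, h] at ht₀
    · refine hsep j₀ hj₀ i hi (Ne.symm hij) t₀ ht₀ ?_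
      have := eval_binomialPoly ht (y i) (D i)
      rw [h, eval_zero] at this
      simpa [ht] using this.symm
  set P := ∏ i ∈ s, binomialPoly (y i) (D i) with hP
  have hPne : P ≠ 0 := prod_ne_zero_iff.2 hP0
  -- Clearing negative powers multiplies `t^m` by `t^(∑ D⁻)`, and `dt/t` removes one power. `hlow`
  -- says that `e ≥ 0` (no pole at `0`), `hupp` that `e + 2 ≤ deg P` (no pole at `∞`).
  obtain ⟨e, he⟩ : ∃ e : ℕ, (e : ℤ) + 1 = m + ∑ i ∈ s, ((-D i).toNat : ℤ) :=
    ⟨(m + ∑ i ∈ s, ((-D i).toNat : ℤ) - 1).toNat, by omega⟩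
  have hroots : P.roots.toFinset = s.biUnion fun j => binomialRoots (y j) (D j) := by
    ext t
    rw [Multiset.mem_toFinset, mem_roots hPne, IsRoot.def, hP, eval_prod, prod_eq_zero_iff]
    simp only [mem_biUnion, Multiset.mem_toFinset, binomialRoots]
    exact exists_congr fun i => and_congr_right fun hi => by rw [mem_roots (hP0 i hi), IsRoot.def]
  have hder : ∀ j ∈ s, ∀ t ∈ binomialRoots (y j) (D j), t * P.derivative.eval t =
      t ^ (∑ i ∈ s, (-D i).toNat) * (D j * ∏ l ∈ s.erase j, (y l * t ^ D l - 1)) := by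
    intro j hj t ht
    obtain ⟨hD, ht0, h1⟩ := (mem_binomialRoots (hy _ hj)).1 ht
    have hsplit : P = binomialPoly (y j) (D j) * ∏ i ∈ s.erase j, binomialPoly (y i) (D i) :=
      (mul_prod_erase s _ hj).symm
    have hz : (binomialPoly (y j) (D j)).eval t = 0 := by
      rw [eval_binomialPoly ht0, h1]; simp
    rw [hsplit, derivative_mul, eval_add, eval_mul, eval_mul, hz, zero_mul, add_zero, ← mul_assoc,
      eval_derivative_binomialPoly ht0 h1, eval_prod,
      prod_congr rfl fun i _ => eval_binomialPoly ht0 (y i) (D i), prod_mul_distrib,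
      prod_pow_eq_pow_sum, ← add_sum_erase s (fun i => (-D i).toNat) hj, pow_add]
    ring
  have hprod : ∀ j ∈ s, ∀ t ∈ binomialRoots (y j) (D j),
      ∏ l ∈ s.erase j, (y l * t ^ D l - 1) ≠ 0 := fun j hj t ht => prod_ne_zero_iff.2 fun l hl =>
    hsep j hj l (mem_of_mem_erase hl) (ne_of_mem_erase hl).symm t ht
  have hmain : ∑ t ∈ P.roots.toFinset, (X ^ e : ℂ[X]).eval t / P.derivative.eval t = 0 := by
    refine sum_eval_div_eval_derivative_eq_zero ?_ ?_
    · intro t ht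
      have ht' : t ∈ P.roots.toFinset := by rw [Multiset.mem_toFinset, mem_roots hPne]; exact ht
      rw [hroots, mem_biUnion] at ht'
      obtain ⟨j, hj, htj⟩ := ht'
      obtain ⟨hD, ht0, -⟩ := (mem_binomialRoots (hy _ hj)).1 htj
      refine right_ne_zero_of_mul (a := t) ?_
      rw [hder j hj t htj]
      exact mul_ne_zero (pow_ne_zero _ ht0)
        (mul_ne_zero (Int.cast_ne_zero.2 hD) (hprod j hj t htj))
    · rw [natDegree_X_pow, hP, natDegree_prod _ _ hP0,
        sum_congr rfl fun i hi => natDegree_binomialPoly (hy i hi) (D i), sum_add_distrib]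
      have : ((∑ i ∈ s, (D i).toNat : ℕ) : ℤ) = ∑ i ∈ s, ((D i).toNat : ℤ) := by push_cast; rfl
      have : ((∑ i ∈ s, (-D i).toNat : ℕ) : ℤ) = ∑ i ∈ s, ((-D i).toNat : ℤ) := by push_cast; rfl
      omega
  rw [hroots, sum_biUnion] at hmain
  · rw [← hmain]
    refine sum_congr rfl fun j hj => sum_congr rfl fun t ht => ?_
    obtain ⟨hD, ht0, -⟩ := (mem_binomialRoots (hy _ hj)).1 ht
    have h1 : t ^ m * t ^ (∑ i ∈ s, (-D i).toNat) = t ^ e * t := by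
      rw [← pow_succ, ← zpow_natCast, ← zpow_natCast, ← zpow_add₀ ht0]
      congr 1
      push_cast
      omega
    have h2 := hprod j hj t ht
    have h3 : (D j : ℂ) ≠ 0 := Int.cast_ne_zero.2 hD
    have h4 := pow_ne_zero (∑ i ∈ s, (-D i).toNat) ht0
    have h5 : P.derivative.eval t ≠ 0 := by
      refine right_ne_zero_of_mul (a := t) ?_
      rw [hder j hj t ht]
      exact mul_ne_zero h4 (mul_ne_zero h3 h2)
    rw [eval_pow, eval_X, div_eq_div_iff (mul_ne_zero h3 h2) h5]
    refine mul_left_cancel₀ (mul_ne_zero h4 ht0) ?_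
    have h6 := hder j hj t ht
    calc _ = (t ^ m * t ^ (∑ i ∈ s, (-D i).toNat)) * (t * P.derivative.eval t) := by ring
      _ = _ := by rw [h1, h6]; ring
  · intro i hi j hj hij
    rw [Function.onFun, Finset.disjoint_left]
    intro t hti htj
    refine hsep i hi j hj hij t hti ?_
    rw [((mem_binomialRoots (hy _ hj)).1 htj).2.2, sub_self]

/-! ### Binomial systems on the torus. -/

theorem monomial_mul_left {d : ℕ} (z w : Fin d → ℂ) (n : Fin d → ℤ) :
    monomial (fun k => z k * w k) n = monomial z n * monomial w n := by
  simp only [monomial, mul_zpow, prod_mul_distrib]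

theorem zpow_sum {ι : Type*} {t : ℂ} (ht : t ≠ 0) (s : Finset ι) (e : ι → ℤ) :
    t ^ (∑ k ∈ s, e k) = ∏ k ∈ s, t ^ e k := by
  classical
  induction s using Finset.induction_on with
  | empty => simp
  | insert a s ha ih => rw [sum_insert ha, prod_insert ha, zpow_add₀ ht, ih]

theorem monomial_zpow {d : ℕ} {t : ℂ} (ht : t ≠ 0) (c n : Fin d → ℤ) :
    monomial (fun k => t ^ c k) n = t ^ (∑ k, c k * n k) := by
  rw [zpow_sum ht]
  simp only [monomial, zpow_mul]

theorem monomial_ne_zero {d : ℕ} {z : Fin d → ℂ} (hz : ∀ k, z k ≠ 0) (n : Fin d → ℤ) :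
    monomial z n ≠ 0 :=
  prod_ne_zero_iff.2 fun k _ => zpow_ne_zero _ (hz k)

theorem monomial_vecMul {d : ℕ} {z : Fin d → ℂ} (hz : ∀ k, z k ≠ 0) (m : Fin d → ℤ)
    (M : Matrix (Fin d) (Fin d) ℤ) :
    monomial z (m ᵥ* M) = ∏ c, monomial z (M c) ^ m c := by
  simp only [monomial, Matrix.vecMul, dotProduct, ← prod_zpow]
  rw [prod_comm]
  refine prod_congr rfl fun k _ => ?_
  rw [zpow_sum (hz k)]
  exact prod_congr rfl fun c _ => by rw [mul_comm, zpow_mul]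

theorem monomial_single {d : ℕ} (z : Fin d → ℂ) (k : Fin d) (n : ℤ) :
    monomial z (Pi.single k n) = z k ^ n := by
  rw [monomial, Fintype.prod_eq_single k fun l hl => by rw [Pi.single_eq_of_ne hl, zpow_zero],
    Pi.single_eq_same]

/-- The points `z` of the torus `(ℂ^×)^d` with `x_c z^(M_c) = 1` for all rows `M_c` of `M`. -/
def torusSolutions {d : ℕ} (M : Matrix (Fin d) (Fin d) ℤ) (x : Fin d → ℂ) : Set (Fin d → ℂ) :=
  {z | (∀ k, z k ≠ 0) ∧ ∀ c, x c * monomial z (M c) = 1}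

/-- Elimination by Cramer's rule: row `k` of the adjugate gives exponents with which the product of
the equations involves `z k` alone. Finiteness of the solution set and the norm of the coordinates
both follow from this. -/
theorem prod_mul_zpow_det_of_mem_torusSolutions {d : ℕ} {M : Matrix (Fin d) (Fin d) ℤ}
    {x z : Fin d → ℂ} (hz : z ∈ torusSolutions M x) (k : Fin d) :
    (∏ c, x c ^ M.adjugate k c) * z k ^ M.det = 1 := by
  have h : (M.adjugate k) ᵥ* M = Pi.single k M.det := by
    have h1 := congrFun (Matrix.adjugate_mul M) k
    ext l
    have h2 := congrFun h1 l
    rw [Matrix.smul_apply, Matrix.one_apply, smul_eq_mul] at h2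
    rw [Pi.single_apply, show (M.adjugate k ᵥ* M) l = (M.adjugate * M) k l from rfl, h2]
    simp [eq_comm]
  rw [← monomial_single, ← h, monomial_vecMul hz.1, ← prod_mul_distrib]
  exact prod_eq_one fun c _ => by rw [← mul_zpow, hz.2, one_zpow]

theorem finite_torusSolutions {d : ℕ} {M : Matrix (Fin d) (Fin d) ℤ} {x : Fin d → ℂ}
    (hx : ∀ c, x c ≠ 0) (hM : M.det ≠ 0) : (torusSolutions M x).Finite := by
  refine (Set.Finite.pi' fun k => (binomialRoots (∏ c, x c ^ M.adjugate k c)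
    M.det).finite_toSet).subset fun z hz k => ?_
  rw [mem_coe, mem_binomialRoots (prod_ne_zero_iff.2 fun c _ => zpow_ne_zero _ (hx c))]
  exact ⟨hM, hz.1 k, prod_mul_zpow_det_of_mem_torusSolutions hz k⟩

theorem norm_eq_one_of_mem_torusSolutions {d : ℕ} {M : Matrix (Fin d) (Fin d) ℤ}
    {x z : Fin d → ℂ} (hx : ∀ c, ‖x c‖ = 1) (hM : M.det ≠ 0) (hz : z ∈ torusSolutions M x)
    (k : Fin d) : ‖z k‖ = 1 := by
  have h := congrArg norm (prod_mul_zpow_det_of_mem_torusSolutions hz k)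
  simp only [norm_mul, norm_prod, norm_zpow, hx, one_zpow, prod_const_one, one_mul, norm_one] at h
  exact (zpow_left_inj₀ (norm_nonneg _) zero_le_one hM).1 (h.trans (one_zpow _).symm)

/-! ### The cycle relation for residue sums. -/

/-- The rows `b_(T c)` of the square matrix attached to a `d`-tuple `T` of indices. -/
abbrev tupleMatrix {d N : ℕ} (B : Matrix (Fin d) (Fin N) ℤ) (T : Fin d → Fin N) :
    Matrix (Fin d) (Fin d) ℤ :=
  Bᵀ.submatrix T id

theorem tupleMatrix_update {d N : ℕ} (B : Matrix (Fin d) (Fin N) ℤ) (T : Fin d → Fin N)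
    (i : Fin d) (j : Fin N) :
    tupleMatrix B (Function.update T i j) = (tupleMatrix B T).updateRow i (Bᵀ j) := by
  ext c k
  by_cases h : c = i
  · subst h; simp
  · simp [h]

/-- The sum of the residues at the points of `torusSolutions`, with the sign of the determinant
left out: it is an alternating function of the tuple `T`. -/
def residueSum {d N : ℕ} (B : Matrix (Fin d) (Fin N) ℤ) (x : Fin N → ℂ) (τ : Fin d → ℤ)
    (T : Fin d → Fin N) : ℂ :=
  ((tupleMatrix B T).det : ℂ)⁻¹ * ∑ᶠ z ∈ torusSolutions (tupleMatrix B T) (x ∘ T),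
    monomial z τ / ∏ l ∈ (univ.image T)ᶜ, (x l * monomial z (Bᵀ l) - 1)

theorem det_updateRow_eq_sum {d : ℕ} {R : Type*} [CommRing R] (M : Matrix (Fin d) (Fin d) R)
    (i : Fin d) (v : Fin d → R) : (M.updateRow i v).det = ∑ k, Mᵀ.adjugate i k * v k := by
  rw [← Matrix.cramer_transpose_apply, Matrix.cramer_eq_adjugate_mulVec]
  rfl

theorem mem_torusSolutions_updateRow {d : ℕ} {M : Matrix (Fin d) (Fin d) ℤ} {x z : Fin d → ℂ}
    {i : Fin d} {b : Fin d → ℤ} {a : ℂ} :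
    z ∈ torusSolutions (M.updateRow i b) (Function.update x i a) ↔
      (∀ k, z k ≠ 0) ∧ (∀ c, c ≠ i → x c * monomial z (M c) = 1) ∧ a * monomial z b = 1 := by
  refine and_congr_right fun _ => ⟨fun h => ⟨fun c hc => ?_, ?_⟩, fun h c => ?_⟩
  · have := h c
    rwa [Matrix.updateRow_ne hc, Function.update_of_ne hc] at this
  · have := h i
    rwa [Matrix.updateRow_self, Function.update_self] at this
  · by_cases hc : c = i
    · subst hc
      rw [Matrix.updateRow_self, Function.update_self]
      exact h.2
    · rw [Matrix.updateRow_ne hc, Function.update_of_ne hc]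
      exact h.1 c hc

/-- A nonzero integer vector is a positive multiple of a primitive vector. -/
theorem exists_primitive {d : ℕ} {C : Fin d → ℤ} (hC : C ≠ 0) :
    ∃ (g : ℤ) (c u : Fin d → ℤ), g ≠ 0 ∧ (∀ k, C k = g * c k) ∧ ∑ k, c k * u k = 1 := by
  obtain ⟨k₀, hk₀⟩ := Function.ne_iff.1 hC
  obtain ⟨c, hc, hg⟩ := Finset.extract_gcd C ⟨k₀, mem_univ k₀⟩
  obtain ⟨u, hu⟩ := Finset.gcd_eq_sum_mul univ c
  refine ⟨univ.gcd C, c, u, ?_, fun k => hc k (mem_univ k), by rw [← hu, hg]⟩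
  exact Finset.gcd_ne_zero_iff.2 ⟨k₀, mem_univ _, hk₀⟩

/-- The torus solutions of a system are fibred into orbits of the one-parameter subgroup `t^c`
that leaves all equations but the `i`-th invariant. -/
theorem finsum_mem_torusSolutions_updateRow {d : ℕ} {M : Matrix (Fin d) (Fin d) ℤ}
    {x : Fin d → ℂ} (hx : ∀ c, x c ≠ 0) {i : Fin d} {c u : Fin d → ℤ}
    (hcM : ∀ l, l ≠ i → ∑ k, c k * M l k = 0) (hcu : ∑ k, c k * u k = 1)
    (hQ : (torusSolutions (M.updateRow i u) (Function.update x i 1)).Finite)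
    {b : Fin d → ℤ} {a : ℂ} (ha : a ≠ 0) (hb : ∑ k, c k * b k ≠ 0)
    (hdet : (M.updateRow i b).det ≠ 0) (F : (Fin d → ℂ) → ℂ) :
    ∑ᶠ z ∈ torusSolutions (M.updateRow i b) (Function.update x i a), F z =
      ∑ q ∈ hQ.toFinset, ∑ t ∈ binomialRoots (a * monomial q b) (∑ k, c k * b k),
        F fun k => q k * t ^ c k := by
  have hfin : (torusSolutions (M.updateRow i b) (Function.update x i a)).Finite := by
    refine finite_torusSolutions (fun l => ?_) hdet
    by_cases hl : l = i
    · subst hl; simpa using ha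
    · simpa [hl] using hx l
  have hmono : ∀ (q : Fin d → ℂ) (t : ℂ) (n : Fin d → ℤ), t ≠ 0 →
      monomial (fun k => q k * t ^ c k) n = monomial q n * t ^ (∑ k, c k * n k) := by
    intro q t n ht
    rw [monomial_mul_left, monomial_zpow ht]
  rw [finsum_mem_eq_finite_toFinset_sum _ hfin, sum_sigma']
  -- As `c · u = 1`, the monomial `z^u` recovers the parameter `t` on each orbit, and the auxiliary
  -- equation `q^u = 1` selects one representative `q` per orbit.
  refine sum_bij' (fun z _ => ⟨fun k => z k * (monomial z u)⁻¹ ^ c k, monomial z u⟩)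
    (fun p _ => fun k => p.1 k * p.2 ^ c k) ?_ ?_ ?_ ?_ ?_
  · intro z hz
    rw [Set.Finite.mem_toFinset, mem_torusSolutions_updateRow] at hz
    obtain ⟨hz0, hz1, hz2⟩ := hz
    have hu := monomial_ne_zero hz0 u
    have hq0 : ∀ k, z k * (monomial z u)⁻¹ ^ c k ≠ 0 := fun k =>
      mul_ne_zero (hz0 k) (zpow_ne_zero _ (inv_ne_zero hu))
    rw [mem_sigma, Set.Finite.mem_toFinset, mem_torusSolutions_updateRow,
      mem_binomialRoots (mul_ne_zero ha (monomial_ne_zero hq0 _))]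
    refine ⟨⟨hq0, fun l hl => ?_, ?_⟩, hb, hu, ?_⟩
    · rw [hmono _ _ _ (inv_ne_zero hu), hcM l hl, zpow_zero, mul_one, hz1 l hl]
    · rw [hmono _ _ _ (inv_ne_zero hu), hcu, zpow_one, mul_inv_cancel₀ hu, one_mul]
    · rw [hmono _ _ _ (inv_ne_zero hu), mul_assoc, mul_assoc, ← mul_zpow, inv_mul_cancel₀ hu,
        one_zpow, mul_one, hz2]
  · rintro ⟨q, t⟩ hp
    rw [mem_sigma, Set.Finite.mem_toFinset, mem_torusSolutions_updateRow] at hp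
    obtain ⟨⟨hq0, hq1, hq2⟩, ht⟩ := hp
    rw [mem_binomialRoots (mul_ne_zero ha (monomial_ne_zero hq0 _))] at ht
    obtain ⟨-, ht0, ht1⟩ := ht
    rw [Set.Finite.mem_toFinset, mem_torusSolutions_updateRow]
    refine ⟨fun k => mul_ne_zero (hq0 k) (zpow_ne_zero _ ht0), fun l hl => ?_, ?_⟩
    · rw [hmono _ _ _ ht0, hcM l hl, zpow_zero, mul_one, hq1 l hl]
    · rw [hmono _ _ _ ht0, ← mul_assoc, ht1]
  · intro z hz
    rw [Set.Finite.mem_toFinset, mem_torusSolutions_updateRow] at hz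
    have hu := monomial_ne_zero hz.1 u
    funext k
    rw [mul_assoc, ← mul_zpow, inv_mul_cancel₀ hu, one_zpow, mul_one]
  · rintro ⟨q, t⟩ hp
    rw [mem_sigma, Set.Finite.mem_toFinset, mem_torusSolutions_updateRow] at hp
    obtain ⟨⟨hq0, hq1, hq2⟩, ht⟩ := hp
    rw [mem_binomialRoots (mul_ne_zero ha (monomial_ne_zero hq0 _))] at ht
    have htu : monomial (fun k => q k * t ^ c k) u = t := by
      rw [hmono _ _ _ ht.2.1, hcu, zpow_one]
      rw [one_mul] at hq2
      rw [hq2, one_mul]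
    simp only [htu]
    congr 1
    funext k
    rw [mul_assoc, ← mul_zpow, mul_inv_cancel₀ ht.2.1, one_zpow, mul_one]
  · intro z hz
    rw [Set.Finite.mem_toFinset, mem_torusSolutions_updateRow] at hz
    have hu := monomial_ne_zero hz.1 u
    congr 1
    funext k
    rw [mul_assoc, ← mul_zpow, inv_mul_cancel₀ hu, one_zpow, mul_one]

theorem neg_toNat_neg_le_mul {ν : ℝ} (h0 : 0 < ν) (h1 : ν < 1) (D : ℤ) :
    -((-D).toNat : ℝ) ≤ ν * D ∧ ν * D ≤ (D.toNat : ℝ) ∧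
      (D ≠ 0 → -((-D).toNat : ℝ) < ν * D ∧ ν * D < (D.toNat : ℝ)) := by
  rcases lt_trichotomy D 0 with h | h | h
  · have h2 : (((-D).toNat : ℤ) : ℝ) = ((-D : ℤ) : ℝ) := by rw [Int.toNat_of_nonneg (by omega)]
    have h3 : D.toNat = 0 := by omega
    have h4 : (D : ℝ) < 0 := by exact_mod_cast h
    push_cast at h2
    rw [h2, h3]
    push_cast
    refine ⟨by nlinarith, by nlinarith, fun _ => ⟨by nlinarith, by nlinarith⟩⟩
  · subst h; simp
  · have h2 : ((D.toNat : ℤ) : ℝ) = ((D : ℤ) : ℝ) := by rw [Int.toNat_of_nonneg (by omega)]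
    have h3 : (-D).toNat = 0 := by omega
    have h4 : 0 < (D : ℝ) := by exact_mod_cast h
    push_cast at h2
    rw [h2, h3]
    push_cast
    refine ⟨by nlinarith, by nlinarith, fun _ => ⟨by nlinarith, by nlinarith⟩⟩

/-- This is where the openness of the zonotope matters: it yields the strict inequalities that
exclude poles at `0` and `∞`. -/
theorem sum_mul_bounds {ι : Type*} (s : Finset ι) {ν : ι → ℝ} {D : ι → ℤ} {m : ℤ}
    (hν : ∀ i, 0 < ν i ∧ ν i < 1) (hm : (m : ℝ) = ∑ i ∈ s, ν i * D i) (hD : ∃ i ∈ s, D i ≠ 0) :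
    -∑ i ∈ s, ((-D i).toNat : ℤ) < m ∧ m < ∑ i ∈ s, ((D i).toNat : ℤ) := by
  obtain ⟨i₀, hi₀, hD₀⟩ := hD
  have key := fun i => neg_toNat_neg_le_mul (hν i).1 (hν i).2 (D i)
  have h1 : ∑ i ∈ s, -((-D i).toNat : ℝ) < ∑ i ∈ s, ν i * D i :=
    sum_lt_sum (fun i _ => (key i).1) ⟨i₀, hi₀, ((key i₀).2.2 hD₀).1⟩
  have h2 : ∑ i ∈ s, ν i * D i < ∑ i ∈ s, ((D i).toNat : ℝ) :=
    sum_lt_sum (fun i _ => (key i).2.1) ⟨i₀, hi₀, ((key i₀).2.2 hD₀).2⟩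
  rw [← hm] at h1 h2
  rw [sum_neg_distrib] at h1
  exact ⟨by exact_mod_cast h1, by exact_mod_cast h2⟩

/-- The total residue along each of the curves cut out by `d - 1` of the equations vanishes. -/
theorem sum_residueSum_update_eq_zero {d N : ℕ} {B : Matrix (Fin d) (Fin N) ℤ} {x : Fin N → ℂ}
    {τ : Fin d → ℤ} (hx : ∀ j, x j ≠ 0)
    (hnormal : ∀ T, (tupleMatrix B T).det ≠ 0 →
      ∀ z ∈ torusSolutions (tupleMatrix B T) (x ∘ T), ∀ l ∉ univ.image T,
        x l * monomial z (Bᵀ l) - 1 ≠ 0)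
    (hspan : ∀ c : Fin d → ℤ, (∀ j, ∑ k, c k * B k j = 0) → c = 0)
    (hτ : (fun k => (τ k : ℝ)) ∈ openZonotope B) (T : Fin d → Fin N) (i : Fin d) (v : Fin d → ℝ)
    (hv : (((tupleMatrix B T).map (Int.cast : ℤ → ℝ)).updateRow i v).det ≠ 0) :
    ∑ j, residueSum B x τ (Function.update T i j) = 0 := by
  classical
  set M := tupleMatrix B T with hM
  -- These cofactors are the coefficients of the linear form `b ↦ det (M.updateRow i b)`, which is
  -- nonzero because it does not vanish at `v`. The primitive vector `c` on their line annihilates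
  -- the other rows of `M`.
  have hC : Mᵀ.adjugate i ≠ 0 := by
    intro h
    apply hv
    rw [det_updateRow_eq_sum]
    refine sum_eq_zero fun k _ => ?_
    have h2 : ((M.map (Int.cast : ℤ → ℝ))ᵀ).adjugate = (Mᵀ.adjugate).map (Int.cast : ℤ → ℝ) :=
      (RingHom.map_adjugate (Int.castRingHom ℝ) Mᵀ).symm
    rw [h2, Matrix.map_apply, h]
    simp
  obtain ⟨g, c, u, hg, hCc, hcu⟩ := exists_primitive hC
  have hdet : ∀ b : Fin d → ℤ, (M.updateRow i b).det = g * ∑ k, c k * b k := by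
    intro b
    rw [det_updateRow_eq_sum, mul_sum]
    exact sum_congr rfl fun k _ => by rw [hCc]; ring
  have hcM : ∀ l, l ≠ i → ∑ k, c k * M l k = 0 := by
    intro l hl
    have h := hdet (M l)
    rw [Matrix.det_updateRow_eq_zero hl] at h
    exact (mul_eq_zero.1 h.symm).resolve_left hg
  have hQ : (torusSolutions (M.updateRow i u) (Function.update (x ∘ T) i 1)).Finite := by
    refine finite_torusSolutions (fun l => ?_) (by rw [hdet, hcu, mul_one]; exact hg)
    by_cases hl : l = i
    · subst hl; simp
    · simpa [hl] using hx _
  set D : Fin N → ℤ := fun j => ∑ k, c k * B k j with hD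
  set s : Finset (Fin N) := ((univ.erase i).image T)ᶜ with hs
  have hDs : ∀ j ∉ s, D j = 0 := by
    intro j hj
    rw [hs, mem_compl, not_not, mem_image] at hj
    obtain ⟨l, hl, rfl⟩ := hj
    exact hcM l (ne_of_mem_erase hl)
  have hDdet : ∀ j, (tupleMatrix B (Function.update T i j)).det = g * D j := by
    intro j
    rw [tupleMatrix_update, hdet]
    rfl
  have himage : ∀ j, (univ.image (Function.update T i j))ᶜ = s.erase j := by
    intro j
    ext l
    simp only [hs, mem_compl, mem_image, mem_univ, true_and, mem_erase, not_exists, and_true]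
    constructor
    · refine fun h => ⟨fun hl => h i (by simp [hl]), fun k hk => ?_⟩
      have := h k
      rw [Function.update_of_ne hk.1] at this
      exact this hk.2
    · rintro ⟨h1, h2⟩ k
      by_cases hk : k = i
      · subst hk; simpa using Ne.symm h1
      · rw [Function.update_of_ne hk]
        exact fun h => h2 k ⟨hk, h⟩
  have hxT : ∀ j, x ∘ Function.update T i j = Function.update (x ∘ T) i (x j) := fun j =>
    Function.comp_update x T i j
  have hmono : ∀ (q : Fin d → ℂ) (t : ℂ) (n : Fin d → ℤ), t ≠ 0 →
      monomial (fun k => q k * t ^ c k) n = monomial q n * t ^ (∑ k, c k * n k) := by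
    intro q t n ht
    rw [monomial_mul_left, monomial_zpow ht]
  have hterm : ∀ j, residueSum B x τ (Function.update T i j) = ∑ q ∈ hQ.toFinset,
      (g : ℂ)⁻¹ * monomial q τ * ∑ t ∈ binomialRoots (x j * monomial q (Bᵀ j)) (D j),
        t ^ (∑ k, c k * τ k) /
          (D j * ∏ l ∈ s.erase j, (x l * monomial q (Bᵀ l) * t ^ D l - 1)) := by
    intro j
    unfold residueSum
    rw [himage, hDdet]
    -- A degenerate tuple contributes nothing on either side: `0⁻¹ = 0` on the left, and
    -- `binomialRoots` is empty for exponent zero on the right.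
    by_cases hDj : D j = 0
    · rw [hDj]
      simp
    rw [tupleMatrix_update, hxT, finsum_mem_torusSolutions_updateRow (x := x ∘ T) (b := Bᵀ j)
      (fun l => hx _) hcM hcu hQ (hx j) hDj (by rw [hdet]; exact mul_ne_zero hg hDj), mul_sum]
    refine sum_congr rfl fun q hq => ?_
    rw [mul_sum (binomialRoots _ _), mul_sum (binomialRoots _ _)]
    refine sum_congr rfl fun t ht => ?_
    rw [Set.Finite.mem_toFinset] at hq
    obtain ⟨-, ht0, -⟩ := (mem_binomialRoots (mul_ne_zero (hx j) (monomial_ne_zero hq.1 _))).1 ht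
    simp only [hmono _ _ _ ht0]
    have hDl : ∀ l, ∑ k, c k * Bᵀ l k = D l := fun l => rfl
    simp only [← mul_assoc, hDl]
    rw [Int.cast_mul, mul_inv, div_eq_mul_inv, div_eq_mul_inv, mul_inv]
    ring
  rw [sum_congr rfl fun j _ => hterm j, sum_comm]
  refine sum_eq_zero fun q hq => ?_
  rw [← mul_sum]
  refine mul_eq_zero_of_right _ ?_
  rw [Set.Finite.mem_toFinset] at hq
  have hy : ∀ j, x j * monomial q (Bᵀ j) ≠ 0 := fun j =>
    mul_ne_zero (hx j) (monomial_ne_zero hq.1 _)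
  rw [mem_torusSolutions_updateRow] at hq
  rw [← sum_subset (subset_univ s) fun j _ hj => ?_]
  · obtain ⟨ν, hν, hτν⟩ := hτ
    -- Pair `τ = ∑ ν_j b_j` with `c`; indices outside `s` have `D j = 0`.
    have hm : ((∑ k, c k * τ k : ℤ) : ℝ) = ∑ j ∈ s, ν j * D j := by
      rw [sum_subset (subset_univ s) fun j _ hj => by rw [hDs j hj]; simp]
      push_cast
      have : ∀ k, (τ k : ℝ) = ∑ j, ν j * (B k j : ℝ) := by
        intro k
        have := congrFun hτν k
        simpa [realCol] using this
      simp only [this, hD, mul_sum, Int.cast_sum, Int.cast_mul]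
      rw [sum_comm]
      exact sum_congr rfl fun j _ => sum_congr rfl fun k _ => by ring
    -- Since `c · u = 1`, `c` is nonzero, and by `hspan` it cannot annihilate all columns of `B`.
    have hDne : ∃ j ∈ s, D j ≠ 0 := by
      by_contra! h
      have hc : c = 0 := hspan c fun j => by
        by_cases hj : j ∈ s
        · exact h j hj
        · exact hDs j hj
      rw [hc] at hcu
      simp at hcu
    obtain ⟨hlow, hupp⟩ := sum_mul_bounds s hν hm hDne
    refine sum_residues_eq_zero s (fun j _ => hy j) hlow hupp fun j hj l hl hjl t ht => ?_
    obtain ⟨hDj, ht0, ht1⟩ := (mem_binomialRoots (hy j)).1 ht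
    have h := hnormal (Function.update T i j) (by rw [hDdet]; exact mul_ne_zero hg hDj)
      (fun k => q k * t ^ c k) ?_ l ?_
    · rwa [hmono _ _ _ ht0, ← mul_assoc] at h
    · rw [tupleMatrix_update, hxT, mem_torusSolutions_updateRow]
      refine ⟨fun k => mul_ne_zero (hq.1 k) (zpow_ne_zero _ ht0), fun l hl => ?_, ?_⟩
      · rw [hmono _ _ _ ht0, hcM l hl, zpow_zero, mul_one, hq.2.1 l hl]
      · rw [hmono _ _ _ ht0, ← mul_assoc]
        exact ht1
    · rw [← mem_compl, himage]
      exact mem_erase.2 ⟨hjl.symm, hl⟩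
  · rw [hDs j hj, sum_eq_zero]
    intro t ht
    exact absurd rfl ((mem_binomialRoots (hy j)).1 ht).1

/-! ### Signed counting of cones. -/

open Classical in
/-- Along a line that meets the walls `y_i` one at a time, the number of entries into a chamber
minus the number of exits is determined by the end points of the positive half-line. -/
theorem indicator_sub_indicator_eq_sum {ι : Type*} [Fintype ι] (pos : ι → Prop) {y : ι → ℝ}
    (hy0 : ∀ i, y i ≠ 0) (hy : Function.Injective y) :
    (if ∀ i, (pos i → y i < 0) ∧ (¬pos i → 0 < y i) then 1 else 0 : ℤ) -
        (if ∀ i, pos i then 1 else 0) =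
      ∑ i, if 0 < y i ∧ ∀ k, (pos k → y k ≤ y i) ∧ (¬pos k → y i ≤ y k) then
        (if pos i then -1 else 1) else 0 := by
  -- The chamber is the interval above every `y i` with `pos i` and below all the others. Only its
  -- end points, the maximum `a` of the former and the minimum `b` of the latter, can contribute,
  -- and injectivity of `y` makes them unique.
  by_cases hP : ∃ i, pos i
  · obtain ⟨a, ha, hmax⟩ := exists_max_image (univ.filter pos) y
      (by obtain ⟨i, hi⟩ := hP; exact ⟨i, by simpa using hi⟩)
    simp only [mem_filter, mem_univ, true_and] at ha hmax
    by_cases hQ : ∃ i, ¬pos i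
    · obtain ⟨b, hb, hmin⟩ := exists_min_image (univ.filter fun i => ¬pos i) y
        (by obtain ⟨i, hi⟩ := hQ; exact ⟨i, by simpa using hi⟩)
      simp only [mem_filter, mem_univ, true_and] at hb hmin
      have hab : a ≠ b := by rintro rfl; exact hb ha
      rw [Fintype.sum_eq_add a b hab]
      · have h1 : (∀ i, (pos i → y i < 0) ∧ (¬pos i → 0 < y i)) ↔ y a < 0 ∧ 0 < y b :=
          ⟨fun h => ⟨(h a).1 ha, (h b).2 hb⟩, fun h i =>
            ⟨fun hi => (hmax i hi).trans_lt h.1, fun hi => h.2.trans_le (hmin i hi)⟩⟩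
        have h2 : ¬∀ i, pos i := fun h => hb (h b)
        have h3 : (0 < y a ∧ ∀ k, (pos k → y k ≤ y a) ∧ (¬pos k → y a ≤ y k)) ↔
            0 < y a ∧ y a ≤ y b :=
          and_congr_right fun _ => ⟨fun h => (h b).2 hb, fun h k =>
            ⟨hmax k, fun hk => h.trans (hmin k hk)⟩⟩
        have h4 : (0 < y b ∧ ∀ k, (pos k → y k ≤ y b) ∧ (¬pos k → y b ≤ y k)) ↔
            0 < y b ∧ y a ≤ y b :=
          and_congr_right fun _ => ⟨fun h => (h a).1 ha, fun h k =>
            ⟨fun hk => (hmax k hk).trans h, hmin k⟩⟩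
        simp only [h1, h2, h3, h4, ha, hb, if_true, if_false]
        rcases lt_or_gt_of_ne (hy0 a) with h | h <;> rcases lt_or_gt_of_ne (hy0 b) with h' | h' <;>
          by_cases h'' : y a ≤ y b <;> simp [h, h', h'', h.not_gt, h'.not_gt] <;> linarith
      · rintro i ⟨hia, hib⟩
        refine if_neg fun h => ?_
        by_cases hi : pos i
        · exact hia (hy (le_antisymm (hmax i hi) ((h.2 a).1 ha)))
        · exact hib (hy (le_antisymm ((h.2 b).2 hb) (hmin i hi)))
    · push Not at hQ
      rw [Fintype.sum_eq_single a]
      · have h1 : (∀ i, (pos i → y i < 0) ∧ (¬pos i → 0 < y i)) ↔ y a < 0 :=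
          ⟨fun h => (h a).1 ha, fun h i =>
            ⟨fun hi => (hmax i hi).trans_lt h, fun hi => absurd (hQ i) hi⟩⟩
        have h3 : (0 < y a ∧ ∀ k, (pos k → y k ≤ y a) ∧ (¬pos k → y a ≤ y k)) ↔ 0 < y a :=
          and_iff_left fun k => ⟨hmax k, fun hk => absurd (hQ k) hk⟩
        simp only [h1, h3, ha, if_pos hQ, if_true]
        rcases lt_or_gt_of_ne (hy0 a) with h | h <;> simp [h, h.not_gt]
      · intro i hia
        exact if_neg fun h => hia (hy (le_antisymm (hmax i (hQ i)) ((h.2 a).1 ha)))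
  · push Not at hP
    rcases isEmpty_or_nonempty ι with hι | ⟨⟨i₀⟩⟩
    · simp
    obtain ⟨b, -, hmin⟩ := exists_min_image univ y ⟨i₀, mem_univ _⟩
    rw [Fintype.sum_eq_single b]
    · have h1 : (∀ i, (pos i → y i < 0) ∧ (¬pos i → 0 < y i)) ↔ 0 < y b :=
        ⟨fun h => (h b).2 (hP b), fun h i =>
          ⟨fun hi => absurd hi (hP i), fun _ => h.trans_le (hmin i (mem_univ _))⟩⟩
      have h2 : ¬∀ i, pos i := fun h => hP b (h b)
      have h3 : (0 < y b ∧ ∀ k, (pos k → y k ≤ y b) ∧ (¬pos k → y b ≤ y k)) ↔ 0 < y b :=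
        and_iff_left fun k => ⟨fun hk => absurd hk (hP k), fun _ => hmin k (mem_univ _)⟩
      simp only [h1, h2, h3, hP b, if_false, sub_zero]
    · intro i hib
      exact if_neg fun h => hib (hy (le_antisymm ((h.2 b).2 (hP b)) (hmin i (mem_univ _))))

theorem vecMul_updateRow {d : ℕ} (c : Fin d → ℝ) (w : Matrix (Fin d) (Fin d) ℝ) (i : Fin d)
    (v : Fin d → ℝ) : c ᵥ* w.updateRow i v = Function.update c i 0 ᵥ* w + c i • v := by
  ext l
  simp only [Matrix.vecMul, dotProduct, Pi.add_apply, Pi.smul_apply, smul_eq_mul]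
  rw [← add_sum_erase univ _ (mem_univ i),
    ← add_sum_erase univ (fun k => Function.update c i 0 k * w k l) (mem_univ i),
    Matrix.updateRow_self, Function.update_self, zero_mul, zero_add, add_comm]
  congr 1
  refine sum_congr rfl fun k hk => ?_
  rw [Matrix.updateRow_ne (ne_of_mem_erase hk), Function.update_of_ne (ne_of_mem_erase hk)]

theorem vecMul_inj {d : ℕ} {w : Matrix (Fin d) (Fin d) ℝ} (hw : w.det ≠ 0) {c c' : Fin d → ℝ} :
    c ᵥ* w = c' ᵥ* w ↔ c = c' :=
  (Matrix.vecMul_injective_iff_isUnit.2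
    ((Matrix.isUnit_iff_isUnit_det w).2 hw.isUnit)).eq_iff

open Classical in
/-- The sign of the determinant of `w` if `ρ` is in the cone generated by the rows of `w`,
and zero otherwise. -/
def coneSign {d : ℕ} (ρ : Fin d → ℝ) (w : Matrix (Fin d) (Fin d) ℝ) : ℤ :=
  if ∃ c : Fin d → ℝ, (∀ k, 0 ≤ c k) ∧ c ᵥ* w = ρ then (SignType.sign w.det : ℤ) else 0

open Classical in
theorem coneSign_vecMul {d : ℕ} {w : Matrix (Fin d) (Fin d) ℝ} (hw : w.det ≠ 0) {q : Fin d → ℝ}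
    (hq : ∀ k, q k ≠ 0) :
    coneSign (q ᵥ* w) w = if ∀ k, 0 < q k then (SignType.sign w.det : ℤ) else 0 := by
  refine if_congr ⟨?_, fun h => ⟨q, fun k => (h k).le, rfl⟩⟩ rfl rfl
  rintro ⟨c, hc, h⟩ k
  rw [vecMul_inj hw] at h
  exact lt_of_le_of_ne (h ▸ hc k) (hq k).symm

/-- In the coordinates given by `w`, the half-line `q + s p`, `s ≥ 0`, starts at `q` and has
limiting direction `p`; it meets the `i`-th coordinate hyperplane at `s = y i`. The point `q` is in
the cone of the other rows and `-p` exactly when this crossing has `s > 0` and lies on the facet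
opposite row `i`; the determinant `-p i * det w` tells entry from exit. `hpq` makes the crossings
distinct. -/
theorem coneSign_sub_coneSign {d : ℕ} {w : Matrix (Fin d) (Fin d) ℝ} (hw : w.det ≠ 0)
    {p q : Fin d → ℝ} (hp : ∀ k, p k ≠ 0) (hq : ∀ k, q k ≠ 0)
    (hpq : ∀ i j, i ≠ j → p i * q j ≠ p j * q i) :
    coneSign (q ᵥ* w) w - coneSign (p ᵥ* w) w =
      ∑ i, coneSign (q ᵥ* w) (w.updateRow i (-(p ᵥ* w))) := by
  classical
  set y : Fin d → ℝ := fun i => -(q i / p i) with hy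
  have hyq : ∀ i, q i = -(y i * p i) := fun i => by
    simp only [hy]; field_simp [hp i]
  have hy0 : ∀ i, y i ≠ 0 := fun i => neg_ne_zero.2 (div_ne_zero (hq i) (hp i))
  have hinj : Function.Injective y := by
    intro i j hij
    by_contra h
    refine hpq i j h ?_
    rw [hyq i, hyq j, hij]; ring
  have hdet : ∀ i, (w.updateRow i (-(p ᵥ* w))).det = -p i * w.det := by
    intro i
    have h := Matrix.det_updateRow_sum w i (-p)
    have h2 : ∑ k, (-p) k • w k = -(p ᵥ* w) := by
      rw [← Matrix.neg_vecMul, Matrix.vecMul_eq_sum]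
    rwa [h2] at h
  have hterm : ∀ i, coneSign (q ᵥ* w) (w.updateRow i (-(p ᵥ* w))) = (SignType.sign w.det : ℤ) *
      if 0 < y i ∧ ∀ k, (0 < p k → y k ≤ y i) ∧ (¬0 < p k → y i ≤ y k) then
        (if 0 < p i then -1 else 1) else 0 := by
    intro i
    have hiff : (∃ c : Fin d → ℝ, (∀ k, 0 ≤ c k) ∧ c ᵥ* w.updateRow i (-(p ᵥ* w)) = q ᵥ* w) ↔
        0 < y i ∧ ∀ k, (0 < p k → y k ≤ y i) ∧ (¬0 < p k → y i ≤ y k) := by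
      have hvec : ∀ c : Fin d → ℝ, c ᵥ* w.updateRow i (-(p ᵥ* w)) =
          (Function.update c i 0 - c i • p) ᵥ* w := by
        intro c
        rw [vecMul_updateRow, Matrix.sub_vecMul, Matrix.smul_vecMul, smul_neg, sub_eq_add_neg]
      have hk : ∀ k, (0 ≤ q k + y i * p k) ↔
          (0 < p k → y k ≤ y i) ∧ (¬0 < p k → y i ≤ y k) := by
        intro k
        rw [hyq k]
        rcases lt_or_gt_of_ne (hp k) with h | h
        · simp only [h.not_gt, false_imp_iff, not_false_eq_true, true_imp_iff, true_and]
          constructor <;> intro h' <;> nlinarith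
        · simp only [h, not_true, false_imp_iff, true_imp_iff, and_true]
          constructor <;> intro h' <;> nlinarith
      simp only [hvec, vecMul_inj hw, ← hk]
      constructor
      · rintro ⟨c, hc, h⟩
        have hci : c i = y i := by
          have := congrFun h i
          simp only [Pi.sub_apply, Function.update_self, Pi.smul_apply, smul_eq_mul, zero_sub] at this
          rw [hyq i, neg_inj] at this
          exact mul_right_cancel₀ (hp i) this
        refine ⟨lt_of_le_of_ne (hci ▸ hc i) (hy0 i).symm, fun k => ?_⟩
        by_cases hki : k = i
        · subst hki
          rw [hyq k]; simp
        · have := congrFun h k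
          simp only [Pi.sub_apply, Function.update_of_ne hki, Pi.smul_apply, smul_eq_mul] at this
          rw [← this, hci]
          simpa using hc k
      · rintro ⟨h1, h2⟩
        -- The crossing point `q + y i • p` has `i`-th coordinate zero, which leaves that slot for
        -- the coefficient `y i` of `-p`.
        refine ⟨Function.update (q + y i • p) i (y i), fun k => ?_, ?_⟩
        · by_cases hki : k = i
          · subst hki; simpa using h1.le
          · simpa [hki] using h2 k
        · ext k
          by_cases hki : k = i
          · subst hki; simp [hyq k]
          · simp [hki]
    rw [coneSign, if_congr hiff rfl rfl, hdet, mul_ite, mul_zero, sign_mul]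
    refine if_congr Iff.rfl ?_ rfl
    rcases lt_or_gt_of_ne (hp i) with h | h
    · rw [sign_pos (by linarith : 0 < -p i), if_neg h.not_gt]; simp
    · rw [sign_neg (by linarith : -p i < 0), if_pos h]; simp
  have hsum : (∑ i, if 0 < y i ∧ ∀ k, (0 < p k → y k ≤ y i) ∧ (¬0 < p k → y i ≤ y k) then
      (if 0 < p i then -1 else 1) else 0 : ℤ) =
      (if ∀ i, (0 < p i → y i < 0) ∧ (¬0 < p i → 0 < y i) then 1 else 0) -
        (if ∀ i, 0 < p i then 1 else 0) := by
    convert (indicator_sub_indicator_eq_sum (fun i => 0 < p i) hy0 hinj).symm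
  rw [sum_congr rfl fun i _ => hterm i, ← mul_sum, hsum, coneSign_vecMul hw hq,
    coneSign_vecMul hw hp, mul_sub, mul_ite, mul_ite, mul_one, mul_zero]
  congr 1
  refine if_congr (forall_congr' fun k => ?_) rfl rfl
  rw [hyq k]
  rcases lt_or_gt_of_ne (hp k) with h | h
  · simp only [h.not_gt, false_imp_iff, not_false_eq_true, true_imp_iff, true_and]
    constructor <;> intro h' <;> nlinarith
  · simp only [h, not_true, false_imp_iff, true_imp_iff, and_true]
    constructor <;> intro h' <;> nlinarith

/-- `ρ` is on none of the hyperplanes spanned by `d - 1` of the rows of `w`. -/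
def IsGenericFor {d : ℕ} (ρ : Fin d → ℝ) (w : Matrix (Fin d) (Fin d) ℝ) : Prop :=
  ∀ c : Fin d → ℝ, c ᵥ* w = ρ → ∀ k, c k ≠ 0

/-- Exchanging `T i` with `j` is an involution of the pairs `(T, j)`. -/
theorem sum_sum_update {d N : ℕ} (i : Fin d) (F : (Fin d → Fin N) → ℂ) :
    ∑ T, ∑ j, F (Function.update T i j) = N * ∑ T, F T := by
  have hinv : Function.Involutive fun p : (Fin d → Fin N) × Fin N =>
      (Function.update p.1 i p.2, p.1 i) := by
    rintro ⟨T, j⟩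
    simp
  have h := Equiv.sum_comp hinv.toPerm fun p : (Fin d → Fin N) × Fin N => F p.1
  simp only [Function.Involutive.coe_toPerm, Fintype.sum_prod_type] at h
  rw [h, mul_sum]
  simp

/-- The rows `b_(T c)`. -/
abbrev tupleRows {d N : ℕ} (b : Fin N → Fin d → ℝ) (T : Fin d → Fin N) :
    Matrix (Fin d) (Fin d) ℝ :=
  Matrix.of fun c => b (T c)

theorem sum_mul_coneSign_eq_of_generic_pair {d N : ℕ} (hN : 0 < N) {b : Fin N → Fin d → ℝ}
    {g : (Fin d → Fin N) → ℂ} (hg : ∀ T, (tupleRows b T).det = 0 → g T = 0)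
    (hcycle : ∀ T i v, ((tupleRows b T).updateRow i v).det ≠ 0 →
      ∑ j, g (Function.update T i j) = 0)
    {ρ ρ' : Fin d → ℝ} (hρ : ∀ T, (tupleRows b T).det ≠ 0 → IsGenericFor ρ (tupleRows b T))
    (hρ' : ∀ T, (tupleRows b T).det ≠ 0 → IsGenericFor ρ' (tupleRows b T))
    (hpair : ∀ T, (tupleRows b T).det ≠ 0 → ∀ p q, p ᵥ* tupleRows b T = ρ' →
      q ᵥ* tupleRows b T = ρ → ∀ i j, i ≠ j → p i * q j ≠ p j * q i) :
    ∑ T, g T * coneSign ρ (tupleRows b T) = ∑ T, g T * coneSign ρ' (tupleRows b T) := by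
  rw [← sub_eq_zero, ← sum_sub_distrib]
  have hT : ∀ T, g T * coneSign ρ (tupleRows b T) - g T * coneSign ρ' (tupleRows b T) =
      ∑ i, g T * coneSign ρ ((tupleRows b T).updateRow i (-ρ')) := by
    intro T
    by_cases hdet : (tupleRows b T).det = 0
    · simp [hg T hdet]
    have hex : ∀ v : Fin d → ℝ, ∃ q, q ᵥ* tupleRows b T = v := fun v =>
      ⟨v ᵥ* (tupleRows b T)⁻¹, by
        rw [Matrix.vecMul_vecMul, Matrix.nonsing_inv_mul _ (Ne.isUnit hdet), Matrix.vecMul_one]⟩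
    obtain ⟨q, hq⟩ := hex ρ
    obtain ⟨p, hp⟩ := hex ρ'
    have h := coneSign_sub_coneSign hdet (hρ' T hdet p hp) (hρ T hdet q hq)
      (hpair T hdet p q hp hq)
    rw [hp, hq] at h
    rw [← mul_sub, ← mul_sum]
    congr 1
    exact_mod_cast congrArg (Int.cast : ℤ → ℂ) h
  rw [sum_congr rfl fun T _ => hT T, sum_comm]
  refine sum_eq_zero fun i _ => ?_
  -- Replace the sum over `T` by `N` times itself, so that the `i`-th entry becomes a free summation
  -- index. The factor `coneSign` does not depend on this entry, and `hcycle` applies.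
  refine (mul_eq_zero.1 ?_).resolve_left (Nat.cast_ne_zero.2 hN.ne' : (N : ℂ) ≠ 0)
  rw [← sum_sum_update i]
  refine sum_eq_zero fun T _ => ?_
  have hupd : ∀ j, (tupleRows b (Function.update T i j)).updateRow i (-ρ') =
      (tupleRows b T).updateRow i (-ρ') := by
    intro j
    ext c k
    by_cases hc : c = i
    · subst hc; simp
    · simp [hc]
  simp only [hupd]
  rw [← sum_mul]
  by_cases hdet : ((tupleRows b T).updateRow i (-ρ')).det = 0
  · simp [coneSign, hdet]
  · rw [hcycle T i _ hdet, zero_mul]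

theorem vecMul_eq_iff {d : ℕ} {w : Matrix (Fin d) (Fin d) ℝ} (hw : w.det ≠ 0)
    {c v : Fin d → ℝ} : c ᵥ* w = v ↔ c = v ᵥ* w⁻¹ := by
  rw [← vecMul_inj hw (c := c), Matrix.vecMul_vecMul, Matrix.nonsing_inv_mul _ (Ne.isUnit hw),
    Matrix.vecMul_one]

open Filter Topology in
/-- The weighted count of the cones containing `ρ` does not depend on `ρ`, if the weights form a
cycle. -/
theorem sum_mul_coneSign_eq {d N : ℕ} (hN : 0 < N) {b : Fin N → Fin d → ℝ}
    {g : (Fin d → Fin N) → ℂ} (hg : ∀ T, (tupleRows b T).det = 0 → g T = 0)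
    (hcycle : ∀ T i v, ((tupleRows b T).updateRow i v).det ≠ 0 →
      ∑ j, g (Function.update T i j) = 0)
    {ρ ρ' : Fin d → ℝ} (hρ : ∀ T, (tupleRows b T).det ≠ 0 → IsGenericFor ρ (tupleRows b T))
    (hρ' : ∀ T, (tupleRows b T).det ≠ 0 → IsGenericFor ρ' (tupleRows b T)) :
    ∑ T, g T * coneSign ρ (tupleRows b T) = ∑ T, g T * coneSign ρ' (tupleRows b T) := by
  set X : (Fin d → Fin N) → (Fin d → ℝ) →ₗ[ℝ] (Fin d → ℝ) := fun T =>
    Matrix.vecMulLinear (tupleRows b T)⁻¹ with hX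
  have hcoord : ∀ T, (tupleRows b T).det ≠ 0 → ∀ c v, c ᵥ* tupleRows b T = v ↔ c = X T v :=
    fun T hT c v => vecMul_eq_iff hT
  -- `φ x` vanishes at `v` exactly when `v` and `ρ` violate the pair condition for `T`, `i`, `j`. It
  -- is a nonzero form: at the `i`-th row of the basis its value is the `j`-th coordinate of `ρ`. So
  -- some direction `u` avoids all the kernels.
  set φ : {x : (Fin d → Fin N) × Fin d × Fin d // (tupleRows b x.1).det ≠ 0 ∧ x.2.1 ≠ x.2.2} →
      Module.Dual ℝ (Fin d → ℝ) := fun x =>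
    X x.1.1 ρ x.1.2.2 • (LinearMap.proj x.1.2.1 ∘ₗ X x.1.1) -
      X x.1.1 ρ x.1.2.1 • (LinearMap.proj x.1.2.2 ∘ₗ X x.1.1) with hφ
  have hφapp : ∀ x v, φ x v = X x.1.1 ρ x.1.2.2 * X x.1.1 v x.1.2.1 -
      X x.1.1 ρ x.1.2.1 * X x.1.1 v x.1.2.2 := fun x v => rfl
  obtain ⟨u, hu⟩ := Module.Dual.exists_forall_ne_zero_of_forall_exists φ (by
    rintro ⟨⟨T, i, j⟩, hT, hij⟩
    refine ⟨Pi.single i 1 ᵥ* tupleRows b T, ?_⟩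
    have h : X T (Pi.single i 1 ᵥ* tupleRows b T) = Pi.single i 1 :=
      ((hcoord T hT _ _).1 rfl).symm
    rw [hφapp]
    simp only [h, Pi.single_eq_same, Pi.single_eq_of_ne (Ne.symm hij), mul_one, mul_zero, sub_zero]
    exact hρ T hT _ ((hcoord T hT _ _).2 rfl) j)
  have hsign : ∀ T, (tupleRows b T).det ≠ 0 → ∀ k, ∀ᶠ ε : ℝ in 𝓝[≠] 0,
      0 < X T ρ' k * X T (ρ' + ε • u) k := by
    intro T hT k
    refine eventually_nhdsWithin_of_eventually_nhds ?_
    have hcont : Continuous fun ε : ℝ => X T ρ' k * (X T ρ' k + ε * X T u k) := by fun_prop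
    have hpos : 0 < X T ρ' k * (X T ρ' k + 0 * X T u k) := by
      rw [zero_mul, add_zero]
      exact mul_self_pos.2 (hρ' T hT _ ((hcoord T hT _ _).2 rfl) k)
    filter_upwards [hcont.continuousAt.eventually_const_lt hpos] with ε hε
    simpa using hε
  have hpair : ∀ x, ∀ᶠ ε : ℝ in 𝓝[≠] 0, φ x (ρ' + ε • u) ≠ 0 := by
    intro x
    simp only [map_add, map_smul, smul_eq_mul]
    by_cases h0 : φ x ρ' = 0
    · filter_upwards [self_mem_nhdsWithin] with ε hε
      rw [h0, zero_add]
      exact mul_ne_zero hε (hu x)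
    · refine eventually_nhdsWithin_of_eventually_nhds ?_
      have hcont : Continuous fun ε : ℝ => φ x ρ' + ε * φ x u := by fun_prop
      exact hcont.continuousAt.eventually_ne (by simpa using h0)
  have hall : ∀ᶠ ε : ℝ in 𝓝[≠] 0, (∀ T, (tupleRows b T).det ≠ 0 → ∀ k,
      0 < X T ρ' k * X T (ρ' + ε • u) k) ∧ ∀ x, φ x (ρ' + ε • u) ≠ 0 := by
    refine Eventually.and (eventually_all.2 fun T => ?_) (eventually_all.2 hpair)
    by_cases hT : (tupleRows b T).det = 0
    · exact Eventually.of_forall fun ε h => absurd hT h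
    · filter_upwards [eventually_all.2 (hsign T hT)] with ε hε _ using hε
  obtain ⟨ε, h1, h2⟩ := hall.exists
  set ρ'' := ρ' + ε • u with hρ''
  -- For the chosen `ε` the point `ρ''` is in general position to `ρ`, while its coordinates in
  -- every basis have the same signs as those of `ρ'`, so the two lie in the same cones.
  rw [sum_mul_coneSign_eq_of_generic_pair hN hg hcycle hρ (ρ' := ρ'')]
  · refine sum_congr rfl fun T _ => ?_
    by_cases hT : (tupleRows b T).det = 0
    · simp [hg T hT]
    congr 2
    have hne'' : ∀ k, X T ρ'' k ≠ 0 := fun k => (mul_ne_zero_iff.1 (h1 T hT k).ne').2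
    have hne' : ∀ k, X T ρ' k ≠ 0 := fun k => (mul_ne_zero_iff.1 (h1 T hT k).ne').1
    have e1 := coneSign_vecMul hT hne''
    have e2 := coneSign_vecMul hT hne'
    rw [(hcoord T hT _ _).2 rfl] at e1 e2
    rw [e1, e2]
    exact if_congr (forall_congr' fun k => (pos_iff_pos_of_mul_pos (h1 T hT k)).symm) rfl rfl
  · intro T hT c hc k
    rw [(hcoord T hT _ _).1 hc]
    exact (mul_ne_zero_iff.1 (h1 T hT k).ne').2
  · intro T hT p q hp hq i j hij h
    rw [hcoord T hT] at hp hq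
    refine h2 ⟨(T, i, j), hT, hij⟩ ?_
    rw [hφapp]
    simp only [← hp, ← hq]
    linarith

/-! ### Non-resonance and normal crossings. -/

theorem injective_of_det_ne_zero {d N : ℕ} {B : Matrix (Fin d) (Fin N) ℤ} {T : Fin d → Fin N}
    (hT : (tupleMatrix B T).det ≠ 0) : Function.Injective T := by
  intro a b hab
  by_contra h
  exact hT (Matrix.det_zero_of_row_eq h (by ext k; simp [hab]))

theorem HasBasisRows.eq_zero {d N : ℕ} {B : Matrix (Fin d) (Fin N) ℤ}
    {L : Submodule ℤ (Fin N → ℤ)} (hB : HasBasisRows B L) (c : Fin d → ℤ)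
    (hc : ∀ j, ∑ k, c k * B k j = 0) : c = 0 := by
  funext k
  refine Fintype.linearIndependent_iff.1 hB.1 c ?_ k
  ext j
  simpa [Matrix.row] using hc j

/-- Gale duality: an integer relation between the columns of `A` in `J` is a vector `κ B` of `L`
that vanishes on `T`, and invertibility of the minor forces `κ = 0`. -/
theorem linearIndependent_realCol_compl {N d r : ℕ} {L : Submodule ℤ (Fin N → ℤ)}
    {A : Matrix (Fin r) (Fin N) ℤ} (hA : IsIntegerKernel A L)
    {B : Matrix (Fin d) (Fin N) ℤ} (hB : HasBasisRows B L) {T : Fin d → Fin N}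
    (hT : (tupleMatrix B T).det ≠ 0) {J : Finset (Fin N)} (hJ : ∀ c, T c ∉ J) :
    LinearIndependent ℝ (fun j : J => realCol A j) := by
  have h : LinearIndependent ℤ (fun j : J => (fun k => A k j : Fin r → ℤ)) := by
    rw [Fintype.linearIndependent_iff]
    intro g hg
    set v : Fin N → ℤ := fun j => if h : j ∈ J then g ⟨j, h⟩ else 0 with hv
    have hvJ : ∀ j : J, v j = g j := fun j => by simp [hv]
    have hvL : v ∈ L := by
      rw [hA]
      ext k
      have h1 := congrFun hg k
      simp only [Finset.sum_apply, Pi.smul_apply, smul_eq_mul, Pi.zero_apply] at h1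
      rw [Pi.zero_apply, ← h1, Matrix.mulVec, dotProduct, ← sum_subset (subset_univ J) fun j _ hj => by
        simp [hv, hj], ← sum_coe_sort J]
      exact sum_congr rfl fun j _ => by rw [hvJ, mul_comm]
    rw [← hB.2, Submodule.mem_span_range_iff_exists_fun] at hvL
    obtain ⟨κ, hκ⟩ := hvL
    have hκ0 : κ = 0 := by
      refine Matrix.eq_zero_of_mulVec_eq_zero hT ?_
      ext c
      have h1 := congrFun hκ (T c)
      simp only [hv, hJ c, dif_neg, not_false_eq_true, Finset.sum_apply, Pi.smul_apply,
        smul_eq_mul, Matrix.row] at h1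
      rw [Pi.zero_apply, ← h1, Matrix.mulVec, dotProduct]
      exact sum_congr rfl fun k _ => mul_comm (B k (T c)) (κ k)
    intro j
    rw [← hvJ, ← hκ, hκ0]
    simp
  have h' := (linearIndependent_algebraMap_comp_iff (R := ℤ) (S := ℝ)
    (v := fun j : J => (fun k => A k j : Fin r → ℤ))).2 h
  exact h'

/-- Under total non-resonance, `γ^μ` is not integral at any index outside a cotriangle on which it
is integral. -/
theorem gammaVec_ne_intCast {N d r : ℕ} (hr : d + r = N) {L : Submodule ℤ (Fin N → ℤ)}
    {A : Matrix (Fin r) (Fin N) ℤ} (hA : IsIntegerKernel A L)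
    {B : Matrix (Fin d) (Fin N) ℤ} (hB : HasBasisRows B L)
    {α : Fin r → ℝ} (hα : TotallyNonResonant A α)
    {γ₀ : Fin N → ℝ} (hγ : (A.map (fun n : ℤ => (n : ℝ))) *ᵥ γ₀ = α)
    {T : Fin d → Fin N} (hT : (tupleMatrix B T).det ≠ 0) {μ : Fin d → ℝ}
    (hμ : ∀ c, ∃ n : ℤ, gammaVec B γ₀ μ (T c) = n) {l : Fin N} (hl : l ∉ univ.image T) (n : ℤ) :
    gammaVec B γ₀ μ l ≠ n := by
  intro hn
  set J : Finset (Fin N) := (insert l (univ.image T))ᶜ with hJ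
  have hcardJ : J.card + 1 = r := by
    have h1 : (insert l (univ.image T)).card = d + 1 := by
      rw [card_insert_of_notMem hl, card_image_of_injective _ (injective_of_det_ne_zero hT)]
      simp
    have h2 := card_le_univ (insert l (univ.image T))
    rw [hJ, card_compl, h1, Fintype.card_fin]
    rw [h1, Fintype.card_fin] at h2
    omega
  have hTJ : ∀ c, T c ∉ J := fun c => by simp [hJ]
  -- Since `A Bᵀ = 0`, `α = A γ^μ`. Subtracting the integral vector `A ⌊γ^μ⌋` leaves the combination
  -- of the `a_j` with the fractional parts as coefficients. Integrality on `T` and at `l` would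
  -- leave only the `r - 1` independent columns in `J`.
  refine hα J hcardJ (linearIndependent_realCol_compl hA hB hT hTJ)
    (fun k => -∑ j, A k j * ⌊gammaVec B γ₀ μ j⌋)
    ⟨fun j => Int.fract (gammaVec B γ₀ μ j), fun j _ => Int.fract_nonneg _, ?_⟩
  have hzero : ∀ j ∉ J, Int.fract (gammaVec B γ₀ μ j) = 0 := by
    intro j hj
    rw [hJ, mem_compl, not_not, mem_insert, mem_image] at hj
    rcases hj with rfl | ⟨c, -, rfl⟩
    · rw [hn, Int.fract_intCast]
    · obtain ⟨m, hm⟩ := hμ c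
      rw [hm, Int.fract_intCast]
  rw [sum_subset (subset_univ J) fun j _ hj => by
    rw [show (fun j => Int.fract (gammaVec B γ₀ μ j)) j = 0 from hzero j hj, zero_smul]]
  ext k
  have hAB : ∀ i, ∑ j, (A k j : ℝ) * (B i j : ℝ) = 0 := by
    intro i
    have h1 : B.row i ∈ L := by
      rw [← hB.2]
      exact Submodule.subset_span ⟨i, rfl⟩
    have h2 := congrFun ((hA _).1 h1) k
    simp only [Matrix.mulVec, dotProduct, Matrix.row, Pi.zero_apply] at h2
    exact_mod_cast congrArg (Int.cast : ℤ → ℝ) h2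
  have hαk : α k = ∑ j, (A k j : ℝ) * gammaVec B γ₀ μ j := by
    rw [← hγ]
    simp only [gammaVec, mul_add, sum_add_distrib, mul_sum]
    rw [sum_comm, add_comm]
    conv_rhs => rw [sum_eq_zero fun i _ => by
      rw [sum_congr rfl fun j _ => mul_left_comm (A k j : ℝ) (μ i) (B i j : ℝ), ← mul_sum, hAB,
        mul_zero]]
    rw [zero_add]
    rfl
  rw [hαk, Finset.sum_apply]
  push_cast
  rw [← sub_eq_add_neg, ← sum_sub_distrib]
  refine sum_congr rfl fun j _ => ?_
  simp only [Pi.smul_apply, smul_eq_mul, realCol, Int.fract]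
  ring

/-! ### Solution points as points of the torus. -/

/-- The coefficient `x_j = e^{2 π i γ_{0,j}}`. -/
def coeffX {N : ℕ} (γ₀ : Fin N → ℝ) (j : Fin N) : ℂ :=
  Complex.exp (2 * Real.pi * Complex.I * (γ₀ j : ℂ))

theorem norm_exp_two_pi_I_mul (t : ℝ) : ‖Complex.exp (2 * Real.pi * Complex.I * (t : ℂ))‖ = 1 := by
  rw [show 2 * (Real.pi : ℂ) * Complex.I * (t : ℂ) = ((2 * Real.pi * t : ℝ) : ℂ) * Complex.I by
    push_cast; ring]
  exact Complex.norm_exp_ofReal_mul_I _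

theorem exp_two_pi_I_mul_eq_iff (s t : ℝ) :
    Complex.exp (2 * Real.pi * Complex.I * (s : ℂ)) =
      Complex.exp (2 * Real.pi * Complex.I * (t : ℂ)) ↔ ∃ n : ℤ, s = t + n := by
  rw [Complex.exp_eq_exp_iff_exists_int]
  refine exists_congr fun n => ?_
  rw [show 2 * (Real.pi : ℂ) * Complex.I * (t : ℂ) + n * (2 * Real.pi * Complex.I) =
    2 * Real.pi * Complex.I * ((t + n : ℝ) : ℂ) by push_cast; ring]
  have h : (2 * (Real.pi : ℂ) * Complex.I) ≠ 0 := Complex.two_pi_I_ne_zero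
  rw [mul_right_inj' h]
  exact Complex.ofReal_inj

theorem zeta_ne_zero {d : ℕ} (μ : Fin d → ℝ) (k : Fin d) : zeta μ k ≠ 0 := Complex.exp_ne_zero _

theorem injOn_zeta {d : ℕ} :
    Set.InjOn (zeta (d := d)) {μ | ∀ k, μ k ∈ Set.Ico (0 : ℝ) 1} := by
  intro μ hμ ν hν h
  funext k
  obtain ⟨n, hn⟩ := (exp_two_pi_I_mul_eq_iff (μ k) (ν k)).1 (congrFun h k)
  obtain ⟨h1, h2⟩ := hμ k
  obtain ⟨h3, h4⟩ := hν k
  have h5 : (-1 : ℝ) < n := by linarith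
  have h6 : (n : ℝ) < 1 := by linarith
  have h7 : n = 0 := by
    have h5' : -1 < n := by exact_mod_cast h5
    have h6' : n < 1 := by exact_mod_cast h6
    omega
  simpa [h7] using hn

theorem exists_zeta_eq {d : ℕ} {z : Fin d → ℂ} (hz : ∀ k, ‖z k‖ = 1) :
    ∃ μ : Fin d → ℝ, (∀ k, μ k ∈ Set.Ico (0 : ℝ) 1) ∧ zeta μ = z := by
  refine ⟨fun k => Int.fract ((z k).arg / (2 * Real.pi)), fun k =>
    ⟨Int.fract_nonneg _, Int.fract_lt_one _⟩, ?_⟩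
  funext k
  have h1 : Complex.exp (2 * Real.pi * Complex.I * (((z k).arg / (2 * Real.pi) : ℝ) : ℂ)) = z k := by
    conv_rhs => rw [← Complex.norm_mul_exp_arg_mul_I (z k), hz k, Complex.ofReal_one, one_mul]
    congr 1
    have : (Real.pi : ℂ) ≠ 0 := Complex.ofReal_ne_zero.2 Real.pi_ne_zero
    push_cast
    field_simp
  rw [← h1, zeta, exp_two_pi_I_mul_eq_iff]
  exact ⟨-⌊(z k).arg / (2 * Real.pi)⌋, by rw [Int.fract]; push_cast; ring⟩

theorem coeffX_mul_monomial_zeta {d N : ℕ} (B : Matrix (Fin d) (Fin N) ℤ) (γ₀ : Fin N → ℝ)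
    (μ : Fin d → ℝ) (j : Fin N) : coeffX γ₀ j * monomial (zeta μ) (Bᵀ j) =
      Complex.exp (2 * Real.pi * Complex.I * (gammaVec B γ₀ μ j : ℂ)) := by
  have h : monomial (zeta μ) (Bᵀ j) =
      Complex.exp (∑ k, (B k j : ℂ) * (2 * Real.pi * Complex.I * (μ k : ℂ))) := by
    rw [Complex.exp_sum]
    refine prod_congr rfl fun k _ => ?_
    rw [zeta, Complex.exp_int_mul, Matrix.transpose_apply]
  rw [h, coeffX, ← Complex.exp_add]
  congr 1
  simp only [gammaVec]
  push_cast
  rw [mul_add, mul_sum]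
  congr 1
  exact sum_congr rfl fun k _ => by ring

theorem coeffX_mul_monomial_zeta_eq_one_iff {d N : ℕ} (B : Matrix (Fin d) (Fin N) ℤ)
    (γ₀ : Fin N → ℝ) (μ : Fin d → ℝ) (j : Fin N) :
    coeffX γ₀ j * monomial (zeta μ) (Bᵀ j) = 1 ↔ ∃ n : ℤ, gammaVec B γ₀ μ j = n := by
  have h := exp_two_pi_I_mul_eq_iff (gammaVec B γ₀ μ j) 0
  rw [Complex.ofReal_zero, mul_zero, Complex.exp_zero] at h
  rw [coeffX_mul_monomial_zeta, h]
  simp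

theorem zeta_mem_torusSolutions_iff {d N : ℕ} {B : Matrix (Fin d) (Fin N) ℤ}
    {γ₀ : Fin N → ℝ} {T : Fin d → Fin N} {μ : Fin d → ℝ} :
    zeta μ ∈ torusSolutions (tupleMatrix B T) (coeffX γ₀ ∘ T) ↔
      ∀ c, ∃ n : ℤ, gammaVec B γ₀ μ (T c) = n := by
  refine (and_iff_right (zeta_ne_zero μ)).trans (forall_congr' fun c => ?_)
  exact coeffX_mul_monomial_zeta_eq_one_iff B γ₀ μ (T c)

theorem exists_zeta_eq_of_mem_torusSolutions {d N : ℕ} {B : Matrix (Fin d) (Fin N) ℤ}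
    {γ₀ : Fin N → ℝ} {T : Fin d → Fin N} (hT : (tupleMatrix B T).det ≠ 0) {z : Fin d → ℂ}
    (hz : z ∈ torusSolutions (tupleMatrix B T) (coeffX γ₀ ∘ T)) :
    ∃ μ : Fin d → ℝ, (∀ k, μ k ∈ Set.Ico (0 : ℝ) 1) ∧ zeta μ = z :=
  exists_zeta_eq (norm_eq_one_of_mem_torusSolutions (fun _ => norm_exp_two_pi_I_mul _) hT hz)

theorem mul_deriv_f_update {d N : ℕ} (B : Matrix (Fin d) (Fin N) ℤ) (γ₀ : Fin N → ℝ)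
    (j : Fin N) {z : Fin d → ℂ} (hz : ∀ k, z k ≠ 0) (k : Fin d) :
    z k * deriv (fun w => f B γ₀ j (Function.update z k w)) (z k) =
      B k j * (coeffX γ₀ j * monomial z (Bᵀ j)) := by
  have hmono : ∀ w, monomial (Function.update z k w) (Bᵀ j) =
      w ^ B k j * ∏ l ∈ univ.erase k, z l ^ B l j := by
    intro w
    rw [monomial, ← mul_prod_erase univ _ (mem_univ k), Function.update_self]
    congr 1
    exact prod_congr rfl fun l hl => by rw [Function.update_of_ne (ne_of_mem_erase hl)]; rfl
  have hfun : (fun w => f B γ₀ j (Function.update z k w)) = fun w =>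
      coeffX γ₀ j * (w ^ B k j * ∏ l ∈ univ.erase k, z l ^ B l j) - 1 := by
    funext w
    rw [← hmono]
    rfl
  have hd : HasDerivAt (fun w => f B γ₀ j (Function.update z k w))
      (coeffX γ₀ j * (B k j * z k ^ (B k j - 1) * ∏ l ∈ univ.erase k, z l ^ B l j)) (z k) := by
    rw [hfun]
    exact (((hasDerivAt_zpow _ _ (Or.inl (hz k))).mul_const _).const_mul _).sub_const 1
  have hm : monomial z (Bᵀ j) = z k ^ B k j * ∏ l ∈ univ.erase k, z l ^ B l j := by
    rw [← hmono, Function.update_eq_self]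
  have hzk : z k * z k ^ (B k j - 1) = z k ^ B k j := by
    rw [zpow_sub_one₀ (hz k), mul_left_comm, mul_inv_cancel₀ (hz k), mul_one]
  rw [hd.deriv, hm, ← hzk]
  ring

/-- The logarithmic derivative of `f_j` in `z_k` is `B k j * (f_j + 1)`, and `f_j` vanishes at `z`
for `j ∈ I`. -/
theorem jacobian_eq_det {d N : ℕ} (B : Matrix (Fin d) (Fin N) ℤ) (γ₀ : Fin N → ℝ)
    {I : Finset (Fin N)} (hI : I.card = d) {z : Fin d → ℂ} (hz : ∀ k, z k ≠ 0)
    (h : ∀ j ∈ I, coeffX γ₀ j * monomial z (Bᵀ j) = 1) :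
    jacobian B γ₀ I hI z = ((subB B I hI).det : ℂ) := by
  rw [jacobian, Int.cast_det]
  congr 1
  ext k c
  rw [Matrix.of_apply, mul_deriv_f_update B γ₀ _ hz, h _ (orderEmbOfFin_mem I hI c), mul_one]
  rfl

/-! ### From ordered tuples to cotriangles. -/

theorem tupleRows_realCol {d N : ℕ} (B : Matrix (Fin d) (Fin N) ℤ) (T : Fin d → Fin N) :
    tupleRows (realCol B) T = (tupleMatrix B T).map (Int.cast : ℤ → ℝ) := rfl

theorem det_tupleRows_realCol {d N : ℕ} (B : Matrix (Fin d) (Fin N) ℤ) (T : Fin d → Fin N) :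
    (tupleRows (realCol B) T).det = ((tupleMatrix B T).det : ℝ) := by
  rw [tupleRows_realCol, Int.cast_det]

theorem isCotriangle_image_iff {d N : ℕ} {B : Matrix (Fin d) (Fin N) ℤ} {T : Fin d → Fin N} :
    IsCotriangle B (univ.image T) ↔ (tupleMatrix B T).det ≠ 0 := by
  have key : Function.Injective T →
      (LinearIndependent ℝ (fun i : univ.image T => realCol B i) ↔
        (tupleMatrix B T).det ≠ 0) := by
    intro hinj
    have hbij : Function.Bijective fun c : Fin d =>
        (⟨T c, mem_image_of_mem T (mem_univ c)⟩ : univ.image T) := by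
      refine ⟨fun a b h => hinj (congrArg Subtype.val h), ?_⟩
      rintro ⟨i, hi⟩
      obtain ⟨c, -, rfl⟩ := mem_image.1 hi
      exact ⟨c, rfl⟩
    rw [← linearIndependent_equiv (Equiv.ofBijective _ hbij)]
    have h2 : (LinearIndependent ℝ (tupleRows (realCol B) T).row) ↔
        IsUnit (tupleRows (realCol B) T) := Matrix.linearIndependent_rows_iff_isUnit
    rw [Matrix.isUnit_iff_isUnit_det, isUnit_iff_ne_zero, det_tupleRows_realCol,
      Int.cast_ne_zero] at h2
    exact h2
  constructor
  · rintro ⟨hcard, hli⟩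
    refine (key ?_).1 hli
    rw [← Set.injOn_univ, ← coe_univ, ← card_image_iff, hcard]
    simp
  · intro hT
    have hinj := injective_of_det_ne_zero hT
    exact ⟨by rw [card_image_of_injective _ hinj]; simp, (key hinj).2 hT⟩

theorem mem_cone_image_iff {d N : ℕ} {B : Matrix (Fin d) (Fin N) ℤ} {T : Fin d → Fin N}
    (hT : Function.Injective T) {ρ : Fin d → ℝ} :
    ρ ∈ cone B (univ.image T) ↔
      ∃ c : Fin d → ℝ, (∀ k, 0 ≤ c k) ∧ c ᵥ* tupleRows (realCol B) T = ρ := by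
  have hsum : ∀ c : Fin N → ℝ, ∑ i ∈ univ.image T, c i • realCol B i =
      (c ∘ T) ᵥ* tupleRows (realCol B) T := by
    intro c
    rw [sum_image fun a _ b _ h => hT h, Matrix.vecMul_eq_sum]
    rfl
  constructor
  · rintro ⟨c, hc, rfl⟩
    exact ⟨c ∘ T, fun k => hc _ (mem_image_of_mem T (mem_univ k)), (hsum c).symm⟩
  · rintro ⟨c, hc, rfl⟩
    refine ⟨Function.extend T c 0, fun i hi => ?_, ?_⟩
    · obtain ⟨k, -, rfl⟩ := mem_image.1 hi
      rw [hT.extend_apply]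
      exact hc k
    · rw [hsum, show Function.extend T c 0 ∘ T = c from funext fun k => hT.extend_apply c 0 k]

theorem IsConvergenceDirection.isGenericFor {d N : ℕ} {B : Matrix (Fin d) (Fin N) ℤ}
    {ρ : Fin d → ℝ} (hρ : IsConvergenceDirection B ρ) {T : Fin d → Fin N}
    (hT : (tupleRows (realCol B) T).det ≠ 0) : IsGenericFor ρ (tupleRows (realCol B) T) := by
  intro c hc k hk
  rw [det_tupleRows_realCol, Int.cast_ne_zero] at hT
  refine hρ ((univ.erase k).image T) ?_ ?_
  · rw [card_image_of_injective _ (injective_of_det_ne_zero hT), card_erase_of_mem (mem_univ k),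
      card_univ, Fintype.card_fin]
    have := k.pos
    omega
  · rw [← hc, Matrix.vecMul_eq_sum, ← add_sum_erase univ _ (mem_univ k), hk, zero_smul, zero_add]
    refine Submodule.sum_mem _ fun l hl => Submodule.smul_mem _ _ (Submodule.subset_span ?_)
    exact ⟨T l, by exact_mod_cast mem_image_of_mem T hl, rfl⟩

theorem exists_perm_of_image_eq {d N : ℕ} {I : Finset (Fin N)} (hI : I.card = d)
    {T : Fin d → Fin N} (hT : univ.image T = I) :
    ∃ σ : Equiv.Perm (Fin d), T = I.orderEmbOfFin hI ∘ σ := by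
  have hinj : Function.Injective T := by
    rw [← Set.injOn_univ, ← coe_univ, ← card_image_iff, hT, hI]
    simp
  have hmem : ∀ c, T c ∈ I := fun c => hT ▸ mem_image_of_mem T (mem_univ c)
  set s : Fin d → Fin d := fun c => (I.orderIsoOfFin hI).symm ⟨T c, hmem c⟩ with hs
  have hsinj : Function.Injective s := fun a b h =>
    hinj (congrArg Subtype.val ((I.orderIsoOfFin hI).symm.injective h))
  refine ⟨Equiv.ofBijective s (Finite.injective_iff_bijective.1 hsinj), ?_⟩
  funext c
  simp only [Function.comp_apply, Equiv.ofBijective_apply, hs, ← coe_orderIsoOfFin_apply,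
    OrderIso.apply_symm_apply]

theorem image_orderEmbOfFin_comp {d N : ℕ} {I : Finset (Fin N)} (hI : I.card = d)
    (σ : Equiv.Perm (Fin d)) : univ.image (I.orderEmbOfFin hI ∘ σ) = I := by
  rw [← image_image, image_univ_of_surjective σ.surjective]
  ext i
  simp

theorem card_filter_image_eq {d N : ℕ} {I : Finset (Fin N)} (hI : I.card = d) :
    (univ.filter fun T : Fin d → Fin N => univ.image T = I).card = d.factorial := by
  have h : (univ.filter fun T : Fin d → Fin N => univ.image T = I) =
      univ.image fun σ : Equiv.Perm (Fin d) => (I.orderEmbOfFin hI ∘ σ : Fin d → Fin N) := by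
    ext T
    simp only [mem_filter, mem_univ, true_and, mem_image]
    constructor
    · intro hT
      obtain ⟨σ, hσ⟩ := exists_perm_of_image_eq hI hT
      exact ⟨σ, hσ.symm⟩
    · rintro ⟨σ, rfl⟩
      exact image_orderEmbOfFin_comp hI σ
  rw [h, card_image_of_injective, card_univ, Fintype.card_perm, Fintype.card_fin]
  intro σ σ' hσ
  ext c
  have := congrFun hσ c
  exact congrArg Fin.val ((I.orderEmbOfFin hI).injective this)

theorem det_subB_eq {d N : ℕ} (B : Matrix (Fin d) (Fin N) ℤ) {I : Finset (Fin N)}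
    (hI : I.card = d) :
    (subB B I hI).det = (tupleMatrix B (I.orderEmbOfFin hI)).det := by
  rw [← Matrix.det_transpose]
  rfl

/-- Reordering the columns changes the sign and the determinant by the same factor. -/
theorem sign_div_det_eq {d N : ℕ} (B : Matrix (Fin d) (Fin N) ℤ) {I : Finset (Fin N)}
    (hI : I.card = d) {T : Fin d → Fin N} (hT : univ.image T = I) :
    ((subB B I hI).det.sign : ℂ) / ((subB B I hI).det : ℂ) =
      ((tupleMatrix B T).det.sign : ℂ) / ((tupleMatrix B T).det : ℂ) := by
  obtain ⟨σ, rfl⟩ := exists_perm_of_image_eq hI hT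
  have h : (tupleMatrix B (I.orderEmbOfFin hI ∘ σ)).det =
      Equiv.Perm.sign σ * (tupleMatrix B (I.orderEmbOfFin hI)).det :=
    Matrix.det_permute σ (tupleMatrix B (I.orderEmbOfFin hI))
  rw [h, det_subB_eq]
  rcases Int.units_eq_one_or (Equiv.Perm.sign σ) with h1 | h1 <;> simp [h1]

/-- The property that all the functions `f_l` outside a cotriangle are nonzero at the points where
the functions of the cotriangle vanish. -/
def IsNormalCrossing {d N : ℕ} (B : Matrix (Fin d) (Fin N) ℤ) (γ₀ : Fin N → ℝ) : Prop :=
  ∀ T : Fin d → Fin N, (tupleMatrix B T).det ≠ 0 → ∀ μ : Fin d → ℝ,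
    (∀ c, ∃ n : ℤ, gammaVec B γ₀ μ (T c) = n) → ∀ l ∉ univ.image T, ∀ n : ℤ,
      gammaVec B γ₀ μ l ≠ n

theorem mem_indexSet {d N : ℕ} {B : Matrix (Fin d) (Fin N) ℤ} {γ₀ : Fin N → ℝ} {μ : Fin d → ℝ}
    {j : Fin N} : j ∈ indexSet B γ₀ μ ↔ ∃ n : ℤ, gammaVec B γ₀ μ j = n := by
  simp [indexSet]

theorem IsNormalCrossing.indexSet_eq_iff {d N : ℕ} {B : Matrix (Fin d) (Fin N) ℤ}
    {γ₀ : Fin N → ℝ} (h : IsNormalCrossing B γ₀) {T : Fin d → Fin N}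
    (hT : (tupleMatrix B T).det ≠ 0) {μ : Fin d → ℝ} :
    indexSet B γ₀ μ = univ.image T ↔ ∀ c, ∃ n : ℤ, gammaVec B γ₀ μ (T c) = n := by
  constructor
  · intro hμ c
    rw [← mem_indexSet, hμ]
    exact mem_image_of_mem T (mem_univ c)
  · intro hμ
    ext j
    rw [mem_indexSet]
    constructor
    · rintro ⟨n, hn⟩
      by_contra hj
      exact h T hT μ hμ j hj n hn
    · intro hj
      obtain ⟨c, -, rfl⟩ := mem_image.1 hj
      exact hμ c

theorem residue_eq {d N : ℕ} {B : Matrix (Fin d) (Fin N) ℤ} {γ₀ : Fin N → ℝ} (τ : Fin d → ℤ)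
    {T : Fin d → Fin N} (hT : (tupleMatrix B T).det ≠ 0) {μ : Fin d → ℝ}
    (hμ : indexSet B γ₀ μ = univ.image T) :
    residue B γ₀ τ μ = ((tupleMatrix B T).det.sign : ℂ) / ((tupleMatrix B T).det : ℂ) *
      (monomial (zeta μ) τ /
        ∏ l ∈ (univ.image T)ᶜ, (coeffX γ₀ l * monomial (zeta μ) (Bᵀ l) - 1)) := by
  have hI : (indexSet B γ₀ μ).card = d := by
    rw [hμ]
    exact (isCotriangle_image_iff.2 hT).1
  rw [residue, dif_pos hI, jacobian_eq_det B γ₀ hI (zeta_ne_zero μ) fun j hj =>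
    (coeffX_mul_monomial_zeta_eq_one_iff B γ₀ μ j).2 (mem_indexSet.1 hj),
    ← sign_div_det_eq B hI hμ.symm, ← hμ, div_mul_div_comm, mul_div_assoc]
  rfl

theorem coneSign_realCol {d N : ℕ} {B : Matrix (Fin d) (Fin N) ℤ} {T : Fin d → Fin N}
    {ρ : Fin d → ℝ} (h : univ.image T ∈ cotrianglesAt B ρ) :
    coneSign ρ (tupleRows (realCol B) T) = (tupleMatrix B T).det.sign := by
  have hT := isCotriangle_image_iff.1 h.1
  rw [coneSign, if_pos ((mem_cone_image_iff (injective_of_det_ne_zero hT)).1 h.2),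
    det_tupleRows_realCol]
  rcases lt_trichotomy (tupleMatrix B T).det 0 with h | h | h
  · rw [Int.sign_eq_neg_one_of_neg h, sign_neg (by exact_mod_cast h)]
    rfl
  · exact absurd h hT
  · rw [Int.sign_eq_one_of_pos h, sign_pos (by exact_mod_cast h)]
    rfl

/-- `zeta` embeds the solution points into the union of the finite sets `torusSolutions` over the
finitely many nondegenerate tuples. -/
theorem finite_solutionPoints {d N : ℕ} {B : Matrix (Fin d) (Fin N) ℤ} {γ₀ : Fin N → ℝ}
    (𝓘 : Set (Finset (Fin N))) : (solutionPoints B γ₀ 𝓘).Finite := by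
  refine Set.Finite.of_finite_image (f := zeta) ?_ (injOn_zeta.mono fun μ hμ => hμ.1.1)
  have hfin : (⋃ T : {T : Fin d → Fin N // (tupleMatrix B T).det ≠ 0},
      torusSolutions (tupleMatrix B T) (coeffX γ₀ ∘ T)).Finite :=
    Set.finite_iUnion fun T => finite_torusSolutions (fun _ => Complex.exp_ne_zero _) T.2
  refine hfin.subset ?_
  rintro _ ⟨μ, ⟨⟨-, I, hI, hint⟩, -⟩, rfl⟩
  have himg : univ.image (I.orderEmbOfFin hI.1) = I := by
    simp
  refine Set.mem_iUnion.2 ⟨⟨I.orderEmbOfFin hI.1, isCotriangle_image_iff.1 (himg.symm ▸ hI)⟩, ?_⟩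
  exact zeta_mem_torusSolutions_iff.2 fun c => hint _ (orderEmbOfFin_mem I hI.1 c)

theorem mem_solutionPoints_and_indexSet_eq_iff {d N : ℕ} {B : Matrix (Fin d) (Fin N) ℤ}
    {γ₀ : Fin N → ℝ} (h : IsNormalCrossing B γ₀) {𝓘 : Set (Finset (Fin N))} {T : Fin d → Fin N}
    (hT : (tupleMatrix B T).det ≠ 0) (hmem : univ.image T ∈ 𝓘) {μ : Fin d → ℝ} :
    μ ∈ solutionPoints B γ₀ 𝓘 ∧ indexSet B γ₀ μ = univ.image T ↔
      (∀ k, μ k ∈ Set.Ico (0 : ℝ) 1) ∧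
        zeta μ ∈ torusSolutions (tupleMatrix B T) (coeffX γ₀ ∘ T) := by
  rw [zeta_mem_torusSolutions_iff, ← h.indexSet_eq_iff hT]
  constructor
  · exact fun hμ => ⟨hμ.1.1.1, hμ.2⟩
  · rintro ⟨h1, h2⟩
    exact ⟨⟨⟨h1, univ.image T, isCotriangle_image_iff.2 hT, fun i hi =>
      mem_indexSet.1 (h2 ▸ hi)⟩, h2 ▸ hmem⟩, h2⟩

-- On `𝓘_ρ` the factor `coneSign` restores the sign of the determinant left out of `residueSum`; for
-- all other tuples both sides vanish.
open Classical in
theorem sum_residue_filter_eq {d N : ℕ} {B : Matrix (Fin d) (Fin N) ℤ} {γ₀ : Fin N → ℝ}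
    (h : IsNormalCrossing B γ₀) (τ : Fin d → ℤ) (ρ : Fin d → ℝ) (T : Fin d → Fin N) :
    ∑ μ ∈ (finite_solutionPoints (B := B) (γ₀ := γ₀) (cotrianglesAt B ρ)).toFinset with
      indexSet B γ₀ μ = univ.image T, residue B γ₀ τ μ =
        residueSum B (coeffX γ₀) τ T * coneSign ρ (tupleRows (realCol B) T) := by
  by_cases hmem : univ.image T ∈ cotrianglesAt B ρ
  · have hT := isCotriangle_image_iff.1 hmem.1
    have hfin : (torusSolutions (tupleMatrix B T) (coeffX γ₀ ∘ T)).Finite :=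
      finite_torusSolutions (fun _ => Complex.exp_ne_zero _) hT
    rw [coneSign_realCol hmem, residueSum, finsum_mem_eq_finite_toFinset_sum _ hfin,
      mul_right_comm, mul_comm _ (((tupleMatrix B T).det.sign : ℤ) : ℂ), ← div_eq_mul_inv, mul_sum]
    refine sum_bij (fun μ _ => zeta μ) ?_ ?_ ?_ ?_
    · intro μ hμ
      rw [mem_filter, Set.Finite.mem_toFinset,
        mem_solutionPoints_and_indexSet_eq_iff h hT hmem] at hμ
      rw [Set.Finite.mem_toFinset]
      exact hμ.2
    · intro μ hμ ν hν hμν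
      rw [mem_filter, Set.Finite.mem_toFinset,
        mem_solutionPoints_and_indexSet_eq_iff h hT hmem] at hμ hν
      exact injOn_zeta hμ.1 hν.1 hμν
    · intro z hz
      rw [Set.Finite.mem_toFinset] at hz
      obtain ⟨μ, hμ, rfl⟩ := exists_zeta_eq_of_mem_torusSolutions hT hz
      refine ⟨μ, ?_, rfl⟩
      rw [mem_filter, Set.Finite.mem_toFinset,
        mem_solutionPoints_and_indexSet_eq_iff h hT hmem]
      exact ⟨hμ, hz⟩
    · intro μ hμ
      exact residue_eq τ hT (mem_filter.1 hμ).2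
  · have hzero : residueSum B (coeffX γ₀) τ T * coneSign ρ (tupleRows (realCol B) T) = 0 := by
      by_cases hT : (tupleMatrix B T).det = 0
      · simp [residueSum, hT]
      · have hcone : ¬∃ c : Fin d → ℝ, (∀ k, 0 ≤ c k) ∧ c ᵥ* tupleRows (realCol B) T = ρ :=
          fun hc => hmem ⟨isCotriangle_image_iff.2 hT,
            (mem_cone_image_iff (injective_of_det_ne_zero hT)).2 hc⟩
        rw [coneSign, if_neg hcone, Int.cast_zero, mul_zero]
    rw [hzero]
    refine sum_eq_zero fun μ hμ => ?_
    rw [mem_filter, Set.Finite.mem_toFinset] at hμ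
    exact absurd (hμ.2 ▸ hμ.1.2) hmem

/-- The index set of each solution point is the image of exactly `d!` tuples. -/
theorem factorial_mul_finsum_residue_eq {d N : ℕ} {B : Matrix (Fin d) (Fin N) ℤ} {γ₀ : Fin N → ℝ}
    (h : IsNormalCrossing B γ₀) (τ : Fin d → ℤ) (ρ : Fin d → ℝ) :
    d.factorial * ∑ᶠ μ ∈ solutionPoints B γ₀ (cotrianglesAt B ρ), residue B γ₀ τ μ =
      ∑ T, residueSum B (coeffX γ₀) τ T * coneSign ρ (tupleRows (realCol B) T) := by
  classical
  rw [finsum_mem_eq_finite_toFinset_sum _ (finite_solutionPoints _),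
    sum_congr rfl fun T _ => (sum_residue_filter_eq h τ ρ T).symm]
  simp only [sum_filter]
  rw [sum_comm, mul_sum]
  refine sum_congr rfl fun μ hμ => ?_
  rw [Set.Finite.mem_toFinset] at hμ
  rw [← sum_filter, sum_const, nsmul_eq_mul, ← card_filter_image_eq hμ.2.1.1]
  simp only [eq_comm]

end AHyp

end

theorem mainTheorem3 (N d r : ℕ) (hN : 0 < N) (hr : d + r = N)
    (L : Submodule ℤ (Fin N → ℤ)) (hL : AHyp.IsHypergeometricLattice d L)
    (A : Matrix (Fin r) (Fin N) ℤ) (hA : AHyp.IsIntegerKernel A L)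
    (B : Matrix (Fin d) (Fin N) ℤ) (hB : AHyp.HasBasisRows B L)
    (α : Fin r → ℝ) (hα : AHyp.TotallyNonResonant A α)
    (γ₀ : Fin N → ℝ) (hγ : (A.map (fun n : ℤ => (n : ℝ))) *ᵥ γ₀ = α)
    (𝓘 𝓙 : Set (Finset (Fin N)))
    (h𝓘 : AHyp.IsCotriangulation B 𝓘) (h𝓙 : AHyp.IsCotriangulation B 𝓙)
    (τ : Fin d → ℤ) (hτ : (fun k => (τ k : ℝ)) ∈ AHyp.openZonotope B) :
    (AHyp.solutionPoints B γ₀ 𝓘).Finite ∧ (AHyp.solutionPoints B γ₀ 𝓙).Finite ∧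
      (∑ᶠ μ ∈ AHyp.solutionPoints B γ₀ 𝓘, AHyp.residue B γ₀ τ μ) =
        ∑ᶠ ν ∈ AHyp.solutionPoints B γ₀ 𝓙, AHyp.residue B γ₀ τ ν := by
  refine ⟨AHyp.finite_solutionPoints _, AHyp.finite_solutionPoints _, ?_⟩
  have hnc : AHyp.IsNormalCrossing B γ₀ := fun T hT μ hμ l hl n =>
    AHyp.gammaVec_ne_intCast hr hA hB hα hγ hT hμ hl n
  obtain ⟨ρ, hρ, rfl⟩ := h𝓘
  obtain ⟨ρ', hρ', rfl⟩ := h𝓙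
  refine mul_left_cancel₀ (Nat.cast_ne_zero.2 d.factorial_ne_zero : (d.factorial : ℂ) ≠ 0) ?_
  rw [AHyp.factorial_mul_finsum_residue_eq hnc, AHyp.factorial_mul_finsum_residue_eq hnc]
  refine AHyp.sum_mul_coneSign_eq hN (fun T hT => ?_) (fun T i v hv => ?_)
    (fun T hT => hρ.isGenericFor hT) (fun T hT => hρ'.isGenericFor hT)
  · rw [AHyp.det_tupleRows_realCol, Int.cast_eq_zero] at hT
    simp [AHyp.residueSum, hT]
  · refine AHyp.sum_residueSum_update_eq_zero (fun _ => Complex.exp_ne_zero _) ?_ hB.eq_zero hτ T i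
      v hv
    -- Points of `torusSolutions` have the form `zeta μ`, where vanishing of `f_l` means integrality
    -- of `γ^μ` at `l`; this turns `hnc` into the statement about poles.
    intro T hT z hz l hl h
    obtain ⟨μ, -, rfl⟩ := AHyp.exists_zeta_eq_of_mem_torusSolutions hT hz
    obtain ⟨n, hn⟩ := (AHyp.coeffX_mul_monomial_zeta_eq_one_iff B γ₀ μ l).1 (sub_eq_zero.1 h)
    exact hnc T hT μ (AHyp.zeta_mem_torusSolutions_iff.1 hz) l hl n hn
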